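/- **Setting.** Let $d\in\{2,3\}$ and let $\Omega\subset\mathbb R^d$ be a bounded connected open set. $H^1_0(\Omega)^d$ is the closure in $H^1(\Omega)^d$ of the smooth fields with compact support in $\Omega$, $L^2_0(\Omega)=\{f\in L^2(\Omega):\int_\Omega f=0\}$, $\boldsymbol\varepsilon(\mathbf w)=\frac12(\nabla\mathbf w+(\nabla\mathbf w)^t)$, and $\|\cdot\|$ is the $L^2(\Omega)$ norm (matrices carry the Frobenius norm). Let $\alpha,\nu,\varrho,E_1,\delta>0$, $E_2<0$ with $E_1-d|E_2|>0$, and $\lambda_1,\lambda_2\in\mathbb R$. Put $F(f)=E_1(1+\lambda_1f)-d|E_2|(1+\lambda_2f)$, let $T_\delta f=f$ if $|f|\le\delta$ and $T_\delta f=\delta\,\mathrm{sign}(f)$ otherwise, and set $$\gamma_1=\tfrac1{1+|\lambda_1|\delta},\quad \gamma_2=\tfrac1{1-|\lambda_1|\delta},\quad \gamma_3=E_1+dE_2,\quad \gamma_4=E_1\lambda_1+dE_2\lambda_2,$$ $$\gamma_5=\tfrac1{\gamma_3+|\gamma_4|\delta},\quad \gamma_6=\tfrac1{\gamma_3-|\gamma_4|\delta},\quad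 \gamma_7=1-|\lambda_2|\delta,\quad \gamma_8=1+|\lambda_2|\delta.$$ Assume that $|\lambda_1|,|\lambda_2|$ are so small that $1-|\lambda_1|\delta>0$, $1-|\lambda_2|\delta>0$ and $\gamma_3-|\gamma_4|\delta>0$. **Discrete spaces.** Let $U_h,X_h\subset H^1_0(\Omega)^d$ and $Q_h\subset L^2_0(\Omega)$ be finite-dimensional subspaces, and let $\beta^*>0$ be a constant for which the discrete inf-sup condition $$\beta^*\le\inf_{0\ne q\in Q_h}\ \sup_{0\ne\mathbf w\in X_h}\frac{\int_\Omega q\,\mathrm{div}\,\mathbf w}{\|q\|\,\|\nabla\mathbf w\|}$$ holds. Put $V_h=\{\mathbf w\in X_h:\int_\Omega q\,\mathrm{div}\,\mathbf w=0\ \ \forall q\in Q_h\}$. Let $h,C>0$ and let $\Pi_h:H^1_0(\Omega)^d\to U_h$ be a map with $\|\nabla\Pi_h\mathbf w\|\le C\|\nabla\mathbf w\|$ and $\|\mathbf w-\Pi_h\mathbf w\|\le Ch\|\nabla\mathbf w\|$ for all $\mathbf w\in H^1_0(\Omega)^d$. **Scheme.** Let $T>0$, let $N>1$ be an integer, $\Delta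 t=T/N$ and $t_n=n\Delta t$. Let $\mathbf u_h^n\in U_h$, $\mathbf v_h^n\in V_h$ ($0\le n\le N$) and $p_h^n\in Q_h$ ($1\le n\le N$) satisfy, for $1\le n\le N$, all $\mathbf z\in U_h$ and all $\mathbf w\in X_h$, with $\tau=T_\delta\,\mathrm{div}\,\mathbf u_h^{n-1}$, $$\frac{\alpha}{\Delta t}\int_\Omega(\mathbf u_h^n-\mathbf u_h^{n-1})\cdot\mathbf z+\frac1{E_1}\int_\Omega\frac{\boldsymbol\varepsilon(\mathbf u_h^n):\boldsymbol\varepsilon(\mathbf z)}{1+\lambda_1\tau}+\frac{|E_2|}{E_1}\int_\Omega\frac{1+\lambda_2\tau}{1+\lambda_1\tau}\,\frac{\mathrm{div}\,\mathbf u_h^n\,\mathrm{div}\,\mathbf z}{F(\tau)}=\alpha\int_\Omega\mathbf v_h^n\cdot\mathbf z,$$ $$\frac{\varrho}{\Delta t}\int_\Omega(\mathbf v_h^n-\mathbf v_h^{n-1})\cdot\mathbf w-\int_\Omega p_h^n\,\mathrm{div}\,\mathbf w+\nu\int_\Omega\nabla\mathbf v_h^n:\nabla\mathbf w+\alpha\int_\Omega\mathbf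 v_h^n\cdot\mathbf w=\frac{\alpha}{\Delta t}\int_\Omega(\mathbf u_h^n-\mathbf u_h^{n-1})\cdot\mathbf w.$$ Let $p_h(t)=p_h^i$ for $t\in\,]t_{i-1},t_i]$, $1\le i\le N$. **Constants.** Let $\mathcal P,\mathcal K>0$ denote constants in the Poincaré and Korn inequalities $\|\mathbf w\|\le\mathcal P\|\nabla\mathbf w\|$ and $\|\nabla\mathbf w\|\le\mathcal K\|\boldsymbol\varepsilon(\mathbf w)\|$ on $H^1_0(\Omega)^d$, and put $$\mathcal D_1=\frac{(\gamma_6\gamma_8)^2}{\gamma_5\gamma_7}|E_2|,\quad \mathcal D_2=1+\frac{\mathcal D_1}2,\quad \mathcal D_3=\frac{(\alpha h)^2}{\Delta t}+\frac{\alpha}{E_1}\frac{\gamma_2^2}{\gamma_1}\mathcal D_2,\quad \mathcal D_4=(\alpha\mathcal P)^2\Big(1+\frac{E_1\mathcal K^2}{\alpha\gamma_1}\mathcal D_3\Big),$$ $$C_1=\|\mathbf v_h^0\|^2+\frac{3C^2\mathcal D_3}{\nu\varrho}\|\mathbf u_h^0\|^2,\quad C_2=\frac{9C^2\mathcal D_4}{\nu\varrho},\quad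 C_3=\frac{\mathcal P}{\beta^*}\big(\varrho\|\mathbf v_h^0\|+2\alpha\|\mathbf u_h^0\|\big),$$ $$C_4=\frac{\mathcal P}{\beta^*}\Big(\alpha\mathcal P\mathcal K\Big(\frac{E_1\varrho}{2\gamma_1}\Big)^{1/2}+\varrho\Big(1+\frac T\varrho\Big(\frac{\nu}{\mathcal P^2}+\frac\alpha2\Big)\Big)^{1/2}\Big).$$ **Proposition.** Constants $\mathcal P,\mathcal K$ as above exist, and for every choice of them such that the time step satisfies $6\,\frac{C^2\mathcal D_4}{\nu\varrho}\,\Delta t\le1$, the function $p_h$ belongs to $W^{-1,\infty}(0,T;L^2_0(\Omega))$, the dual of the space $W^{1,1}_0(0,T;L^2_0(\Omega))$ of those $\varphi\in L^1(0,T;L^2_0(\Omega))$ with weak derivative $\partial_t\varphi\in L^1(0,T;L^2_0(\Omega))$ that vanish at $t=0$ and $t=T$. That is, $\varphi\mapsto\int_0^T\int_\Omega p_h\varphi$ is well defined, linear and continuous on that space, and $$\|p_h\|_{W^{-1,\infty}(0,T;L^2_0(\Omega))}\le 3\Big(C_3+C_4\big(C_1e^{C_2T}\big)^{1/2}\Big).$$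 This holds for the dual norm with respect to $\|\varphi\|_{L^1(0,T;L^2(\Omega))}+\|\partial_t\varphi\|_{L^1(0,T;L^2(\Omega))}$ and also for the dual norm with respect to $\|\partial_t\varphi\|_{L^1(0,T;L^2(\Omega))}$. -/

import Mathlib

open MeasureTheory Set Filter Topology
open scoped ContDiff ENNReal

noncomputable section

namespace PorousFlow

/-! ### The domain and the function spaces -/

/-- Points of `ℝ^d`, and values of vector fields, with the Euclidean norm. -/
abbrev Vec (d : ℕ) : Type := EuclideanSpace ℝ (Fin d)

/-- `d × d` matrices with the Frobenius norm and the Frobenius inner product `A : B`. -/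
abbrev Mat (d : ℕ) : Type := EuclideanSpace ℝ (Fin d × Fin d)

/-- A bounded connected open subset `Ω` of `ℝ^d` (connected sets are nonempty). -/
structure Domain (d : ℕ) where
  carrier : Set (Vec d)
  isOpen : IsOpen carrier
  isConnected : IsConnected carrier
  isBounded : Bornology.IsBounded carrier

variable {d : ℕ}

/-- Lebesgue measure on `Ω`. -/
abbrev Domain.μ (D : Domain d) : Measure (Vec d) := volume.restrict D.carrier

instance (D : Domain d) : IsFiniteMeasure D.μ :=
  ⟨by simpa using D.isBounded.measure_lt_top⟩

/-- `L²(Ω)`. -/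
abbrev L2 (D : Domain d) : Type := Lp ℝ 2 D.μ

/-- `L²(Ω)^d × L²(Ω)^{d × d}`. An element of the space `H¹(Ω)^d` below is represented by the pair
`w = (w.1, w.2)` of the field `w.1` and its weak gradient `w.2`, so `‖w.1‖` is the `L²` norm of the
field and `‖w.2‖` is the `L²` norm of its gradient, that is, the `H¹` seminorm. -/
abbrev FieldGrad (D : Domain d) : Type := Lp (Vec d) 2 D.μ × Lp (Mat d) 2 D.μ

/-- `H¹(Ω)^d`: the pairs `w` such that `w.2 = ∇ w.1` in the weak sense, with the convention
`(∇ w)_{ij} = ∂_j w_i`. -/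
def H1 (D : Domain d) : Set (FieldGrad D) :=
  {w | ∀ φ : Vec d → ℝ, ContDiff ℝ ∞ φ → HasCompactSupport φ → tsupport φ ⊆ D.carrier →
    ∀ i j : Fin d,
      ∫ x in D.carrier, w.1 x i * fderiv ℝ φ x (EuclideanSpace.single j 1) =
        -∫ x in D.carrier, w.2 x (i, j) * φ x}

/-- The classical gradient `(∂_j φ_i)_{ij}` of a differentiable vector field. -/
def classicalGrad (φ : Vec d → Vec d) (x : Vec d) : Mat d :=
  WithLp.toLp 2 fun ij => fderiv ℝ φ x (EuclideanSpace.single ij.2 1) ij.1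

/-- The smooth vector fields with compact support in `Ω`, each paired with its gradient. -/
def testFields (D : Domain d) : Set (FieldGrad D) :=
  {w | ∃ φ : Vec d → Vec d, ContDiff ℝ ∞ φ ∧ HasCompactSupport φ ∧ tsupport φ ⊆ D.carrier ∧
    w.1 =ᵐ[D.μ] φ ∧ w.2 =ᵐ[D.μ] classicalGrad φ}

/-- `H¹₀(Ω)^d`: the closure of the test fields in `H¹(Ω)^d`. -/
def H10 (D : Domain d) : Set (FieldGrad D) :=
  H1 D ∩ closure (testFields D)

/-- The divergence of `w`. -/
def divg {D : Domain d} (w : FieldGrad D) (x : Vec d) : ℝ :=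
  ∑ i, w.2 x (i, i)

/-- The symmetric part `(A + Aᵗ) / 2` of a matrix. -/
def symPart (A : Mat d) : Mat d :=
  WithLp.toLp 2 fun ij => (A (ij.1, ij.2) + A (ij.2, ij.1)) / 2

/-- The strain `ε(w) = (∇w + (∇w)ᵗ) / 2`. -/
def strain {D : Domain d} (w : FieldGrad D) (x : Vec d) : Mat d :=
  symPart (w.2 x)

/-- `‖ε(w)‖_{L²(Ω)}`. -/
def strainNorm {D : Domain d} (w : FieldGrad D) : ℝ :=
  Real.sqrt (∫ x in D.carrier, ‖strain w x‖ ^ 2)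

/-- `cP` is an admissible constant in the Poincaré inequality on `H¹₀(Ω)^d`. -/
def IsPoincareConst (D : Domain d) (cP : ℝ) : Prop :=
  0 < cP ∧ ∀ w ∈ H10 D, ‖w.1‖ ≤ cP * ‖w.2‖

/-- `cK` is an admissible constant in the Korn inequality on `H¹₀(Ω)^d`. -/
def IsKornConst (D : Domain d) (cK : ℝ) : Prop :=
  0 < cK ∧ ∀ w ∈ H10 D, ‖w.2‖ ≤ cK * strainNorm w

/-- `L²₀(Ω)`, the functions in `L²(Ω)` with mean value zero. -/
def L20 (D : Domain d) : Submodule ℝ (L2 D) where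
  carrier := {f | ∫ x in D.carrier, f x = 0}
  zero_mem' := by
    have h : ∫ x in D.carrier, (0 : L2 D) x = ∫ x in D.carrier, (0 : ℝ) :=
      integral_congr_ae (Lp.coeFn_zero ℝ 2 D.μ)
    simpa using h
  add_mem' := by
    intro f g hf hg
    have hfi : Integrable f D.μ := (Lp.memLp f).integrable (by norm_num)
    have hgi : Integrable g D.μ := (Lp.memLp g).integrable (by norm_num)
    have h : ∫ x in D.carrier, (f + g) x = ∫ x in D.carrier, (f x + g x) :=
      integral_congr_ae (Lp.coeFn_add f g)
    simp only [mem_ofPred_eq] at hf hg ⊢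
    rw [h, integral_add hfi hgi, hf, hg, add_zero]
  smul_mem' := by
    intro c f hf
    have h : ∫ x in D.carrier, (c • f) x = ∫ x in D.carrier, c * f x :=
      integral_congr_ae (Lp.coeFn_smul c f)
    simp only [mem_ofPred_eq] at hf ⊢
    rw [h, integral_const_mul, hf, mul_zero]

theorem isClosed_L20 (D : Domain d) : IsClosed (L20 D : Set (L2 D)) := by
  have h : (L20 D : Set (L2 D)) =
      {f : L2 D | inner ℝ (indicatorConstLp 2 MeasurableSet.univ
        (measure_ne_top D.μ univ) (1 : ℝ)) f = 0} := by
    ext f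
    simp only [mem_ofPred_eq]
    rw [L2.inner_indicatorConstLp_one]
    simp [L20]
  rw [h]
  exact isClosed_eq (by fun_prop) continuous_const

instance (D : Domain d) : CompleteSpace (L20 D) :=
  (isClosed_L20 D).completeSpace_coe

/-! ### Spaces of functions of time -/

section Time

variable (T : ℝ) (X : Type) [NormedAddCommGroup X] [NormedSpace ℝ X]

/-- `L¹(0,T;X)`. -/
abbrev L1Time : Type := Lp X 1 (volume.restrict (Ioo (0 : ℝ) T))

variable {T X}

/-- `g = ∂_t f` in the sense of distributions on `]0,T[`. -/
def IsWeakTimeDeriv (f g : L1Time T X) : Prop :=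
  ∀ ψ : ℝ → ℝ, ContDiff ℝ ∞ ψ → HasCompactSupport ψ → tsupport ψ ⊆ Ioo 0 T →
    ∫ t in Ioo 0 T, deriv ψ t • f t = -∫ t in Ioo 0 T, ψ t • g t

/-- The continuous representative of `f` exists and vanishes at `t = 0` and `t = T`. -/
def VanishesAtEnds (f : L1Time T X) : Prop :=
  ∃ F : ℝ → X, ContinuousOn F (Icc 0 T) ∧ f =ᵐ[volume.restrict (Ioo 0 T)] F ∧
    F 0 = 0 ∧ F T = 0

theorem integrable_smul_test {ψ : ℝ → ℝ} (hψ : Continuous ψ) (hc : HasCompactSupport ψ)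
    (f : L1Time T X) :
    Integrable (fun t => ψ t • f t) (volume.restrict (Ioo 0 T)) := by
  obtain ⟨C, hC⟩ := hψ.bounded_above_of_compact_support hc
  exact (L1.integrable_coeFn f).bdd_smul C hψ.aestronglyMeasurable (ae_of_all _ hC)

theorem integral_smul_add {ψ : ℝ → ℝ} (hψ : Continuous ψ) (hc : HasCompactSupport ψ)
    (f g : L1Time T X) :
    ∫ t in Ioo 0 T, ψ t • (f + g) t =
      (∫ t in Ioo 0 T, ψ t • f t) + ∫ t in Ioo 0 T, ψ t • g t := by
  rw [← integral_add (integrable_smul_test hψ hc f) (integrable_smul_test hψ hc g)]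
  refine integral_congr_ae ?_
  filter_upwards [Lp.coeFn_add f g] with t ht
  rw [ht, Pi.add_apply, smul_add]

theorem integral_smul_smul (ψ : ℝ → ℝ) (c : ℝ) (f : L1Time T X) :
    ∫ t in Ioo 0 T, ψ t • (c • f) t = c • ∫ t in Ioo 0 T, ψ t • f t := by
  rw [← integral_smul]
  refine integral_congr_ae ?_
  filter_upwards [Lp.coeFn_smul c f] with t ht
  rw [ht, Pi.smul_apply, smul_comm]

variable (T X)

/-- The pairs `(f, ∂_t f)` in `L¹(0,T;X) × L¹(0,T;X)` with `f` vanishing at `t = 0` and `t = T`. The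
product carries the norm `‖f‖_{L¹(0,T;X)} + ‖∂_t f‖_{L¹(0,T;X)}`. -/
def W110Pairs : Submodule ℝ (WithLp 1 (L1Time T X × L1Time T X)) where
  carrier := {φ | IsWeakTimeDeriv φ.fst φ.snd ∧ VanishesAtEnds φ.fst}
  zero_mem' := by
    refine ⟨?_, fun _ => 0, continuousOn_const, Lp.coeFn_zero X 1 _, rfl, rfl⟩
    intro ψ _ _ _
    have h := integral_smul_smul (T := T) (X := X) (deriv ψ) 0 0
    have h' := integral_smul_smul (T := T) (X := X) ψ 0 0
    simp only [zero_smul] at h h'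
    simp only [WithLp.zero_fst, WithLp.zero_snd]
    rw [h, h', neg_zero]
  add_mem' := by
    rintro φ χ ⟨hφ, F, hF, hFe, hF0, hFT⟩ ⟨hχ, G, hG, hGe, hG0, hGT⟩
    refine ⟨?_, fun t => F t + G t, hF.add hG, ?_, by simp [hF0, hG0], by simp [hFT, hGT]⟩
    · intro ψ h1 h2 h3
      simp only [WithLp.add_fst, WithLp.add_snd]
      rw [integral_smul_add (h1.continuous_deriv (by simp)) h2.deriv,
        integral_smul_add h1.continuous h2, hφ ψ h1 h2 h3, hχ ψ h1 h2 h3, neg_add]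
    · filter_upwards [Lp.coeFn_add φ.fst χ.fst, hFe, hGe] with t h1 h2 h3
      rw [WithLp.add_fst, h1, Pi.add_apply, h2, h3]
  smul_mem' := by
    rintro c φ ⟨hφ, F, hF, hFe, hF0, hFT⟩
    refine ⟨?_, fun t => c • F t, hF.const_smul c, ?_, by simp [hF0], by simp [hFT]⟩
    · intro ψ h1 h2 h3
      simp only [WithLp.smul_fst, WithLp.smul_snd]
      rw [integral_smul_smul, integral_smul_smul, hφ ψ h1 h2 h3, smul_neg]
    · filter_upwards [Lp.coeFn_smul c φ.fst, hFe] with t h1 h2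
      rw [WithLp.smul_fst, h1, Pi.smul_apply, h2]

/-- `W^{1,1}_0(0,T;X)` with the graph norm. -/
def W110 : Type := W110Pairs T X

instance : NormedAddCommGroup (W110 T X) := inferInstanceAs (NormedAddCommGroup (W110Pairs T X))

instance : NormedSpace ℝ (W110 T X) := inferInstanceAs (NormedSpace ℝ (W110Pairs T X))

variable {T X}

/-- The function `φ ∈ L¹(0,T;X)` underlying an element of `W^{1,1}_0(0,T;X)`. -/
def W110.fn (φ : W110 T X) : L1Time T X := (Subtype.val φ).fst

/-- The weak time derivative `∂_t φ`. -/
def W110.timeDeriv (φ : W110 T X) : L1Time T X := (Subtype.val φ).snd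

theorem W110.norm_eq (φ : W110 T X) : ‖φ‖ = ‖φ.fn‖ + ‖φ.timeDeriv‖ :=
  WithLp.prod_norm_eq_of_L1 (Subtype.val φ)

variable (T X)

/-- `W^{-1,∞}(0,T;X)`, the dual space of `W^{1,1}_0(0,T;X)`, with the dual norm. -/
abbrev WNeg1Inf : Type := StrongDual ℝ (W110 T X)

end Time

/-! ### The data of the problem and its constants -/

/-- The coefficients: drag `α`, viscosity `ν`, density `ρ`, the material parameters
`E₁`, `E₂`, `λ₁`, `λ₂`, and the truncation level `δ`. -/
structure Coeffs where
  α : ℝ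
  ν : ℝ
  ρ : ℝ
  E₁ : ℝ
  E₂ : ℝ
  lam₁ : ℝ
  lam₂ : ℝ
  δ : ℝ

namespace Coeffs

/-- `γ₁`, ..., `γ₈`; the constants `γ₃`, ..., `γ₆` depend on the dimension. -/
def γ₁ (c : Coeffs) : ℝ := 1 / (1 + |c.lam₁| * c.δ)
def γ₂ (c : Coeffs) : ℝ := 1 / (1 - |c.lam₁| * c.δ)
def γ₃ (c : Coeffs) (d : ℕ) : ℝ := c.E₁ + d * c.E₂
def γ₄ (c : Coeffs) (d : ℕ) : ℝ := c.E₁ * c.lam₁ + d * c.E₂ * c.lam₂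
def γ₅ (c : Coeffs) (d : ℕ) : ℝ := 1 / (c.γ₃ d + |c.γ₄ d| * c.δ)
def γ₆ (c : Coeffs) (d : ℕ) : ℝ := 1 / (c.γ₃ d - |c.γ₄ d| * c.δ)
def γ₇ (c : Coeffs) : ℝ := 1 - |c.lam₂| * c.δ
def γ₈ (c : Coeffs) : ℝ := 1 + |c.lam₂| * c.δ

/-- The sign conditions on the coefficients in dimension `d`, and the smallness of `λ₁`, `λ₂`
relative to the truncation level that makes `γ₂`, `γ₆` and `γ₇` positive. -/
structure Admissible (c : Coeffs) (d : ℕ) : Prop where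
  α_pos : 0 < c.α
  ν_pos : 0 < c.ν
  ρ_pos : 0 < c.ρ
  E₁_pos : 0 < c.E₁
  E₂_neg : c.E₂ < 0
  E_pos : 0 < c.E₁ - d * |c.E₂|
  δ_pos : 0 < c.δ
  small₁ : 0 < 1 - |c.lam₁| * c.δ
  small₂ : 0 < 1 - |c.lam₂| * c.δ
  small₃ : 0 < c.γ₃ d - |c.γ₄ d| * c.δ

/-- `F(f) = E₁ (1 + λ₁ f) - d |E₂| (1 + λ₂ f)`. -/
def F (c : Coeffs) (d : ℕ) (f : ℝ) : ℝ :=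
  c.E₁ * (1 + c.lam₁ * f) - d * |c.E₂| * (1 + c.lam₂ * f)

/-- `𝒟₁`, ..., `𝒟₄`; here `h` is the mesh size, `dt` the time step, `cP` and `cK` are the Poincaré
and Korn constants. -/
def D₁ (c : Coeffs) (d : ℕ) : ℝ := (c.γ₆ d * c.γ₈) ^ 2 / (c.γ₅ d * c.γ₇) * |c.E₂|
def D₂ (c : Coeffs) (d : ℕ) : ℝ := 1 + c.D₁ d / 2
def D₃ (c : Coeffs) (d : ℕ) (h dt : ℝ) : ℝ :=
  (c.α * h) ^ 2 / dt + c.α / c.E₁ * (c.γ₂ ^ 2 / c.γ₁) * c.D₂ d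
def D₄ (c : Coeffs) (d : ℕ) (h dt cP cK : ℝ) : ℝ :=
  (c.α * cP) ^ 2 * (1 + c.E₁ * cK ^ 2 / (c.α * c.γ₁) * c.D₃ d h dt)

/-- `C₁`, ..., `C₄`; here `C` is the interpolation constant, `β` the inf-sup constant, and `u0`, `v0`
stand for the `L²` norms of the initial discrete displacement and velocity. -/
def C₁ (c : Coeffs) (d : ℕ) (h dt C u0 v0 : ℝ) : ℝ :=
  v0 ^ 2 + 3 * C ^ 2 * c.D₃ d h dt / (c.ν * c.ρ) * u0 ^ 2
def C₂ (c : Coeffs) (d : ℕ) (h dt C cP cK : ℝ) : ℝ :=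
  9 * C ^ 2 * c.D₄ d h dt cP cK / (c.ν * c.ρ)
def C₃ (c : Coeffs) (β cP u0 v0 : ℝ) : ℝ :=
  1 / β * cP * (c.ρ * v0 + 2 * c.α * u0)
def C₄ (c : Coeffs) (T β cP cK : ℝ) : ℝ :=
  cP / β * (c.α * cP * cK * Real.sqrt (c.E₁ * c.ρ / (2 * c.γ₁)) +
    c.ρ * Real.sqrt (1 + T / c.ρ * (c.ν / cP ^ 2 + c.α / 2)))

end Coeffs

/-! ### The discrete scheme -/

/-- The truncation `T_r`. -/
def trunc (r f : ℝ) : ℝ := if |f| ≤ r then f else r * SignType.sign f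

/-- The form `∫_Ω q div w`. -/
def divForm {D : Domain d} (q : L20 D) (w : FieldGrad D) : ℝ :=
  ∫ x in D.carrier, (q : L2 D) x * divg w x

/-- `inf_q sup_w (∫_Ω q div w) / (‖q‖ ‖∇w‖)` over the nonzero `q ∈ Q_h` and `w ∈ X_h`, as an
extended real number. -/
def discreteInfSup {D : Domain d} (Xh : Submodule ℝ (FieldGrad D)) (Qh : Submodule ℝ (L20 D)) :
    EReal :=
  ⨅ q ∈ {q | q ∈ Qh ∧ q ≠ 0}, ⨆ w ∈ {w | w ∈ Xh ∧ w ≠ 0},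
    ((divForm q w / (‖q‖ * ‖w.2‖) : ℝ) : EReal)

/-- `V_h`, the discretely divergence-free fields in `X_h`. -/
def discreteDivFree {D : Domain d} (Xh : Submodule ℝ (FieldGrad D)) (Qh : Submodule ℝ (L20 D)) :
    Set (FieldGrad D) :=
  {w | w ∈ Xh ∧ ∀ q ∈ Qh, divForm q w = 0}

/-- `Pih` (the operator `Π_h`) is a map from `H¹₀(Ω)^d` into `U_h`, stable and of first order with the constant `C`. -/
def IsStableInterp {D : Domain d} (Uh : Submodule ℝ (FieldGrad D)) (h C : ℝ)
    (Pih : FieldGrad D → FieldGrad D) : Prop :=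
  ∀ w ∈ H10 D, Pih w ∈ Uh ∧ ‖(Pih w).2‖ ≤ C * ‖w.2‖ ∧ ‖w.1 - (Pih w).1‖ ≤ C * h * ‖w.2‖

/-- The displacement equation of one time step, from `u'` to `u`, with the new velocity `v`. -/
def DisplacementStep {D : Domain d} (c : Coeffs) (dt : ℝ) (Uh : Submodule ℝ (FieldGrad D))
    (u' u v : FieldGrad D) : Prop :=
  ∀ z ∈ Uh,
    c.α / dt * inner ℝ (u.1 - u'.1) z.1
      + 1 / c.E₁ * (∫ x in D.carrier,
          1 / (1 + c.lam₁ * trunc c.δ (divg u' x)) * inner ℝ (strain u x) (strain z x))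
      + |c.E₂| / c.E₁ * (∫ x in D.carrier,
          (1 + c.lam₂ * trunc c.δ (divg u' x)) / (1 + c.lam₁ * trunc c.δ (divg u' x))
            * (1 / c.F d (trunc c.δ (divg u' x))) * divg u x * divg z x)
      = c.α * inner ℝ v.1 z.1

/-- The fluid equation of one time step, from `(u', v')` to `(u, v)`, with the pressure `p`. -/
def FluidStep {D : Domain d} (c : Coeffs) (dt : ℝ) (Xh : Submodule ℝ (FieldGrad D))
    (u' u v' v : FieldGrad D) (p : L20 D) : Prop :=
  ∀ w ∈ Xh,
    c.ρ / dt * inner ℝ (v.1 - v'.1) w.1 - divForm p w + c.ν * inner ℝ v.2 w.2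
      + c.α * inner ℝ v.1 w.1
      = c.α / dt * inner ℝ (u.1 - u'.1) w.1

/-- `(u^n, v^n)`, `0 ≤ n ≤ N`, and `p^n`, `1 ≤ n ≤ N`, solve the fully discrete scheme with time
step `dt`. -/
structure IsDiscreteSolution {D : Domain d} (c : Coeffs) (dt : ℝ) (N : ℕ)
    (Uh Xh : Submodule ℝ (FieldGrad D)) (Qh : Submodule ℝ (L20 D))
    (u v : ℕ → FieldGrad D) (p : ℕ → L20 D) : Prop where
  u_mem : ∀ n ≤ N, u n ∈ Uh
  v_mem : ∀ n ≤ N, v n ∈ discreteDivFree Xh Qh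
  p_mem : ∀ n, 1 ≤ n → n ≤ N → p n ∈ Qh
  displacement : ∀ n, 1 ≤ n → n ≤ N → DisplacementStep c dt Uh (u (n - 1)) (u n) (v n)
  fluid : ∀ n, 1 ≤ n → n ≤ N → FluidStep c dt Xh (u (n - 1)) (u n) (v (n - 1)) (v n) (p n)

/-- The step function `p_h`, equal to `p^i` on `]t_{i-1}, t_i]`, where `t_i = i dt`. -/
def stepPressure {D : Domain d} (dt : ℝ) (N : ℕ) (p : ℕ → L20 D) (t : ℝ) : L20 D :=
  ∑ i ∈ Finset.Icc 1 N,
    (Ioc (((i : ℝ) - 1) * dt) ((i : ℝ) * dt)).indicator (fun _ => p i) t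

end PorousFlow

end

open PorousFlow

open MeasureTheory Set Filter Topology
open scoped ContDiff ENNReal

noncomputable section

namespace PorousFlow

/-! A single pressure `p^n` is not controlled uniformly in the time step, because the fluid equation
contains difference quotients of `u` and `v`. Its time integral is. Multiplying the fluid equations
by the step and summing makes the quotients telescope, so the impulse `P_m = Δt (p^1 + ... + p^m)`
tested with `div w` involves only nodal values of `u`, `v` and time sums of `v`, `∇v`. The inf-sup
condition turns an energy bound for these into `‖P_m‖ ≤ B` uniformly in `m`
(`IsDiscreteSolution.norm_pressureImpulse_le`). The primitive of `p_h` interpolates the `P_m`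
linearly, so it is bounded by `B` too. Since `φ` vanishes at both ends, `∫ ⟨p_h, φ⟩ = -∫ ⟨P, ∂_t
φ⟩`, which is at most `B` times the `L¹` norm of `∂_t φ`.

The energy bound rests on two tests. The displacement equation is tested with `u^n`
(`displacement_energy`), the fluid equation with `v^n` (`fluid_energy`). The second leaves the drag
term `(u^n - u^{n-1}, v^n)`, and `v^n` need not lie in `U_h`. It is split as `Π_h v^n` plus a
remainder: on the first part the displacement equation replaces the increment by elastic forces, on
the second the first-order error of `Π_h` gives a factor `h`. Young's inequality absorbs half of the
viscous dissipation. The rest is covered by a multiple of the displacement estimate, up to a term in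
`‖v^n‖²` that `discrete_gronwall` handles under the step condition.

The Korn and Poincaré inequalities are proved for test fields by integration by parts and pass to
the closure. -/

variable {d : ℕ}

/-! ### The strain, the divergence and weighted forms -/

/-- The symmetric part of a matrix as a continuous linear map. -/
def symPartL (d : ℕ) : Mat d →L[ℝ] Mat d :=
  LinearMap.toContinuousLinearMap
    { toFun := symPart
      map_add' := by intro A B; ext ij; simp [symPart]; ring
      map_smul' := by intro r A; ext ij; simp [symPart]; ring }

theorem symPartL_apply (A : Mat d) : symPartL d A = symPart A := rfl

/-- The trace of a matrix as a continuous linear map. -/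
def traceL (d : ℕ) : Mat d →L[ℝ] ℝ := ∑ i, EuclideanSpace.proj (i, i)

theorem traceL_apply (A : Mat d) : traceL d A = ∑ i, A (i, i) := by
  simp [traceL]

/-- The strain as an element of `L²`. -/
def strainLp {D : Domain d} (w : FieldGrad D) : Lp (Mat d) 2 D.μ :=
  (symPartL d).compLpL 2 D.μ w.2

/-- The divergence as an element of `L²`. -/
def divLp {D : Domain d} (w : FieldGrad D) : L2 D :=
  (traceL d).compLpL 2 D.μ w.2

theorem coeFn_strainLp {D : Domain d} (w : FieldGrad D) :
    strainLp w =ᵐ[D.μ] strain w := by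
  filter_upwards [(symPartL d).coeFn_compLpL (p := 2) (μ := D.μ) w.2] with x hx
  exact hx

theorem coeFn_divLp {D : Domain d} (w : FieldGrad D) : divLp w =ᵐ[D.μ] divg w := by
  filter_upwards [(traceL d).coeFn_compLpL (p := 2) (μ := D.μ) w.2] with x hx
  rw [divLp, hx, traceL_apply, divg]

theorem norm_sq_eq_integral {E : Type*} [NormedAddCommGroup E] [InnerProductSpace ℝ E]
    {α : Type*} [MeasurableSpace α] {μ : Measure α} (f : Lp E 2 μ) :
    ‖f‖ ^ 2 = ∫ x, ‖f x‖ ^ 2 ∂μ := by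
  rw [← real_inner_self_eq_norm_sq, L2.inner_def]
  simp only [real_inner_self_eq_norm_sq]

theorem strainNorm_eq {D : Domain d} (w : FieldGrad D) : strainNorm w = ‖strainLp w‖ := by
  rw [strainNorm, ← Real.sqrt_sq (norm_nonneg (strainLp w)), norm_sq_eq_integral]
  congr 1
  refine integral_congr_ae ?_
  filter_upwards [coeFn_strainLp w] with x hx
  rw [hx]

theorem divForm_eq_inner {D : Domain d} (q : L20 D) (w : FieldGrad D) :
    divForm q w = inner ℝ (q : L2 D) (divLp w) := by
  rw [divForm, L2.inner_def]
  refine integral_congr_ae ?_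
  filter_upwards [coeFn_divLp w] with x hx
  rw [hx]; simp [mul_comm]

theorem continuous_strainLp {D : Domain d} :
    Continuous (fun w : FieldGrad D => strainLp w) :=
  ((symPartL d).compLpL 2 D.μ).continuous.comp continuous_snd

theorem continuous_divLp {D : Domain d} : Continuous (fun w : FieldGrad D => divLp w) :=
  ((traceL d).compLpL 2 D.μ).continuous.comp continuous_snd

/-! ### Integrals of inner products with bounded weights -/

section Weighted

variable {E : Type*} [NormedAddCommGroup E] [InnerProductSpace ℝ E]
  {α : Type*} [MeasurableSpace α] {μ : Measure α}

theorem abs_integral_weight_inner_le {a : α → ℝ} {M : ℝ} (hM : 0 ≤ M)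
    (ha : ∀ᵐ x ∂μ, |a x| ≤ M) (f g : Lp E 2 μ) :
    |∫ x, a x * inner ℝ (f x) (g x) ∂μ| ≤ M * (‖f‖ * ‖g‖) := by
  have hi : Integrable (fun x => ‖f x‖ * ‖g x‖) μ :=
     MemLp.integrable_mul (p := 2) (q := 2) (Lp.memLp f).norm (Lp.memLp g).norm
  have hp : ∫ x, ‖f x‖ * ‖g x‖ ∂μ ≤ ‖f‖ * ‖g‖ := by
    have hf : MemLp (fun x => ‖f x‖) (ENNReal.ofReal 2) μ := by simpa using (Lp.memLp f).norm
    have hg : MemLp (fun x => ‖g x‖) (ENNReal.ofReal 2) μ := by simpa using (Lp.memLp g).norm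
    have h := integral_mul_le_Lp_mul_Lq_of_nonneg (p := 2) (q := 2) (by constructor <;> norm_num)
      (ae_of_all μ fun x => norm_nonneg (f x)) (ae_of_all μ fun x => norm_nonneg (g x)) hf hg
    simp only [Real.rpow_two, ← norm_sq_eq_integral, ← Real.sqrt_eq_rpow,
      Real.sqrt_sq (norm_nonneg _)] at h
    exact h
  calc |∫ x, a x * inner ℝ (f x) (g x) ∂μ|
      ≤ ∫ x, M * (‖f x‖ * ‖g x‖) ∂μ := by
        rw [← Real.norm_eq_abs]
        refine norm_integral_le_of_norm_le (hi.const_mul M) ?_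
        filter_upwards [ha] with x hx
        rw [Real.norm_eq_abs, abs_mul]
        exact mul_le_mul hx (abs_real_inner_le_norm _ _) (abs_nonneg _) hM
    _ ≤ M * (‖f‖ * ‖g‖) := by
        rw [integral_const_mul]
        exact mul_le_mul_of_nonneg_left hp hM

/-- Measurability and an upper bound of the weight are needed here: they make the weighted integrand
integrable, without which its integral would be zero by convention and the lower bound could fail.
-/
theorem le_integral_weight_inner_self {a : α → ℝ} {m M : ℝ}
    (hm : AEStronglyMeasurable a μ) (ha : ∀ᵐ x ∂μ, m ≤ a x) (ha' : ∀ᵐ x ∂μ, |a x| ≤ M)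
    (f : Lp E 2 μ) :
    m * ‖f‖ ^ 2 ≤ ∫ x, a x * inner ℝ (f x) (f x) ∂μ := by
  have hi : Integrable (fun x => (inner ℝ (f x) (f x) : ℝ)) μ := L2.integrable_inner f f
  rw [← real_inner_self_eq_norm_sq, L2.inner_def, ← integral_const_mul]
  refine integral_mono_ae (hi.const_mul m) (hi.bdd_mul (c := M) hm ha') ?_
  filter_upwards [ha] with x hx
  exact mul_le_mul_of_nonneg_right hx real_inner_self_nonneg

end Weighted

/-! ### The Poincaré and Korn inequalities on `H¹₀` -/

section Smooth

variable {a b : Vec d → ℝ}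

theorem integrable_mul_of_hasCompactSupport (ha : Continuous a) (hb : Continuous b)
    (hc : HasCompactSupport a) : Integrable (fun x => a x * b x) :=
  (ha.mul hb).integrable_of_hasCompactSupport hc.mul_right

theorem contDiff_fderiv_apply (hb : ContDiff ℝ ∞ b) (v : Vec d) :
    ContDiff ℝ ∞ (fun x => fderiv ℝ b x v) :=
  (hb.fderiv_right (by simp)).clm_apply contDiff_const

theorem hasCompactSupport_fderiv_apply (hb : HasCompactSupport b) (v : Vec d) :
    HasCompactSupport (fun x => fderiv ℝ b x v) := by
  exact hb.fderiv_apply (𝕜 := ℝ) v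

theorem hasCompactSupport_sq (hb : HasCompactSupport b) :
    HasCompactSupport (fun x => b x ^ 2) := by
  simp only [pow_two]
  exact hb.mul_left (f := b)

/-- One integration by parts moves a derivative off `a` and gives `-∫ a ∂_v ∂_w b`, which is
symmetric in `v` and `w`. Compact support of `a` alone removes the boundary terms. -/
theorem integral_fderiv_mul_fderiv_swap (ha : ContDiff ℝ ∞ a) (hb : ContDiff ℝ ∞ b)
    (hac : HasCompactSupport a) (v w : Vec d) :
    ∫ x, fderiv ℝ a x v * fderiv ℝ b x w = ∫ x, fderiv ℝ a x w * fderiv ℝ b x v := by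
  have key : ∀ v w : Vec d, ∫ x, fderiv ℝ a x v * fderiv ℝ b x w =
      -∫ x, a x * fderiv ℝ (fderiv ℝ b) x v w := by
    intro v w
    have hbw := contDiff_fderiv_apply hb w
    have h := integral_mul_fderiv_eq_neg_fderiv_mul_of_integrable (μ := volume) (f := a)
      (g := fun x => fderiv ℝ b x w) (v := v)
      (integrable_mul_of_hasCompactSupport (contDiff_fderiv_apply ha v).continuous hbw.continuous
        (hasCompactSupport_fderiv_apply hac v))
      (integrable_mul_of_hasCompactSupport ha.continuous
        (contDiff_fderiv_apply hbw v).continuous hac)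
      (integrable_mul_of_hasCompactSupport ha.continuous hbw.continuous hac)
      (fun x _ => (ha.differentiable (by simp)).differentiableAt)
      (fun x _ => (hbw.differentiable (by simp)).differentiableAt)
    rw [← neg_eq_iff_eq_neg] at h
    rw [← h]
    congr 1
    refine integral_congr_ae (ae_of_all _ fun x => ?_)
    have hd : DifferentiableAt ℝ (fderiv ℝ b) x :=
      ((hb.fderiv_right (m := ∞) (by simp)).differentiable (by simp)).differentiableAt
    have h2 : fderiv ℝ (fun x => fderiv ℝ b x w) x v = fderiv ℝ (fderiv ℝ b) x v w := by
      rw [fderiv_clm_apply hd (differentiableAt_const w)]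
      simp
    simp only [h2]
  rw [key v w, key w v]
  congr 1
  refine integral_congr_ae (ae_of_all _ fun x => ?_)
  have hs : IsSymmSndFDerivAt ℝ b x := hb.contDiffAt.isSymmSndFDerivAt (by
    simpa using WithTop.coe_le_coe.2 (le_top (a := (2 : ℕ∞))))
  simp only [hs.eq v w]

/-- Integrating `a²` against `1 = ∂_k x_k` by parts gives `∫ a² = -∫ 2 a x_k ∂_k a`. With `|x_k| ≤
R` on the support, Young's inequality absorbs half of `∫ a²`, whence the factor `4 R²`. -/
theorem integral_sq_le_of_support_bounded (ha : ContDiff ℝ ∞ a) (hac : HasCompactSupport a)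
    {R : ℝ} (hR : ∀ x ∈ tsupport a, ‖x‖ ≤ R) (k : Fin d) :
    ∫ x, a x ^ 2 ≤ 4 * R ^ 2 * ∫ x, fderiv ℝ a x (EuclideanSpace.single k 1) ^ 2 := by
  set e : Vec d := EuclideanSpace.single k 1 with he
  have hda := contDiff_fderiv_apply ha e
  have hdac := hasCompactSupport_fderiv_apply hac e
  have hproj : ∀ x : Vec d, HasFDerivAt (fun y : Vec d => y k)
      (EuclideanSpace.proj k : Vec d →L[ℝ] ℝ) x :=
    fun x => (EuclideanSpace.proj k : Vec d →L[ℝ] ℝ).hasFDerivAt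
  have hsq : ContDiff ℝ ∞ (fun x => a x ^ 2) := ha.pow 2
  have hsqc : HasCompactSupport (fun x => a x ^ 2) := hasCompactSupport_sq hac
  have hcont : Continuous (fun y : Vec d => y k) := (EuclideanSpace.proj (𝕜 := ℝ) k).continuous
  have h := integral_mul_fderiv_eq_neg_fderiv_mul_of_integrable (μ := volume)
    (f := fun x => a x ^ 2) (g := fun y : Vec d => y k) (v := e)
    (integrable_mul_of_hasCompactSupport (contDiff_fderiv_apply hsq e).continuous hcont
      (hasCompactSupport_fderiv_apply hsqc e))
    (by
      simp only [(hproj _).fderiv]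
      exact integrable_mul_of_hasCompactSupport hsq.continuous continuous_const hsqc)
    (integrable_mul_of_hasCompactSupport hsq.continuous hcont hsqc)
    (fun x _ => (hsq.differentiable (by simp)).differentiableAt)
    (fun x _ => (hproj x).differentiableAt)
  have h1 : ∀ x, fderiv ℝ (fun y : Vec d => y k) x e = 1 := by
    intro x; rw [(hproj x).fderiv]; simp [he]
  have h2 : ∀ x, fderiv ℝ (fun x => a x ^ 2) x e = 2 * a x * fderiv ℝ a x e := by
    intro x
    rw [fderiv_fun_pow 2 (ha.differentiable (by simp)).differentiableAt]
    simp [mul_assoc]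
  simp only [h1, h2, mul_one] at h
  have i1 : Integrable (fun x => a x ^ 2) := hsq.continuous.integrable_of_hasCompactSupport hsqc
  have i2 : Integrable (fun x => fderiv ℝ a x e ^ 2) :=
    (hda.continuous.pow 2).integrable_of_hasCompactSupport (hasCompactSupport_sq hdac)
  have hle : ∫ x, a x ^ 2 ≤ ∫ x, (a x ^ 2 / 2 + 2 * R ^ 2 * fderiv ℝ a x e ^ 2) := by
    conv_lhs => rw [h]
    rw [← integral_neg]
    refine integral_mono ?_ ((i1.div_const 2).add (i2.const_mul _)) ?_
    · refine Integrable.neg ?_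
      have := integrable_mul_of_hasCompactSupport (a := a)
        (b := fun x => 2 * fderiv ℝ a x e * x k) ha.continuous
        ((continuous_const.mul hda.continuous).mul hcont) hac
      refine this.congr (ae_of_all _ fun x => ?_)
      simp only; ring
    · intro x
      simp only
      by_cases hx : x ∈ tsupport a
      · have hxk : |x k| ≤ R := (PiLp.norm_apply_le x k).trans (hR x hx)
        have hk2 : (x k) ^ 2 ≤ R ^ 2 := sq_le_sq' (abs_le.1 hxk).1 (abs_le.1 hxk).2
        nlinarith [sq_nonneg (a x + 2 * (x k) * fderiv ℝ a x e),
          mul_le_mul_of_nonneg_right hk2 (sq_nonneg (fderiv ℝ a x e))]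
      · have : a x = 0 := image_eq_zero_of_notMem_tsupport hx
        rw [this]; simp; positivity
  rw [integral_add (i1.div_const 2) (i2.const_mul _), integral_div, integral_const_mul] at hle
  linarith

end Smooth

theorem setIntegral_eq_integral_of_tsupport_subset {E F : Type*} [NormedAddCommGroup E]
    [Zero F] {φ : Vec d → F} {Ω : Set (Vec d)}
    [NormedSpace ℝ E] (hφ : tsupport φ ⊆ Ω) {g : Vec d → E}
    (hg : ∀ x, x ∉ tsupport φ → g x = 0) : ∫ x in Ω, g x = ∫ x, g x :=
  setIntegral_eq_integral_of_forall_compl_eq_zero fun x hx => hg x fun h => hx (hφ h)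

theorem classicalGrad_apply {φ : Vec d → Vec d} (hφ : ContDiff ℝ ∞ φ) (x : Vec d) (i j : Fin d) :
    classicalGrad φ x (i, j) = fderiv ℝ (fun y => φ y i) x (EuclideanSpace.single j 1) := by
  have h := ((EuclideanSpace.proj i : Vec d →L[ℝ] ℝ).hasFDerivAt.comp x
    (hφ.differentiable (by simp)).differentiableAt.hasFDerivAt).fderiv
  have h' : (fun y => φ y i) = (EuclideanSpace.proj i : Vec d →L[ℝ] ℝ) ∘ φ := rfl
  rw [h', h]
  rfl

theorem classicalGrad_eq_zero {φ : Vec d → Vec d} {x : Vec d} (hx : x ∉ tsupport φ) :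
    classicalGrad φ x = 0 := by
  have : fderiv ℝ φ x = 0 := by
    by_contra hne
    exact hx (support_fderiv_subset ℝ (Function.mem_support.2 hne))
  ext ij
  simp [classicalGrad, this]

theorem integral_sum_sum {ι : Type*} [Fintype ι] {f : ι → ι → Vec d → ℝ}
    (hf : ∀ i j, Integrable (f i j)) :
    ∫ x, ∑ i, ∑ j, f i j x = ∑ i, ∑ j, ∫ x, f i j x := by
  rw [integral_finsetSum _ fun i _ => integrable_finsetSum _ fun j _ => hf i j]
  exact Finset.sum_congr rfl fun i _ => integral_finsetSum _ fun j _ => hf i j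

theorem two_mul_norm_symPart_sq (A : Mat d) :
    2 * ‖symPart A‖ ^ 2 = ‖A‖ ^ 2 + ∑ i, ∑ j, A (i, j) * A (j, i) := by
  simp only [EuclideanSpace.norm_sq_eq, Real.norm_eq_abs, sq_abs, symPart,
    Fintype.sum_prod_type]
  have h : ∑ i, ∑ j, A (j, i) ^ 2 = ∑ i, ∑ j, A (i, j) ^ 2 := Finset.sum_comm
  have : ∑ i, ∑ j, 2 * ((A (i, j) + A (j, i)) / 2) ^ 2 =
      ∑ i, ∑ j, (A (i, j) ^ 2 / 2 + A (j, i) ^ 2 / 2 + A (i, j) * A (j, i)) := by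
    refine Finset.sum_congr rfl fun i _ => Finset.sum_congr rfl fun j _ => ?_
    ring
  simp only [← Finset.mul_sum] at this
  rw [this]
  simp only [Finset.sum_add_distrib, ← Finset.sum_div]
  rw [h]; ring

/-- For a smooth compactly supported field, the strain, the gradient and the divergence satisfy
`2 ‖ε(φ)‖² = ‖∇φ‖² + ‖div φ‖²`. -/
theorem two_mul_strainLp_sq_of_mem_testFields {D : Domain d} {w : FieldGrad D}
    (hw : w ∈ testFields D) : 2 * ‖strainLp w‖ ^ 2 = ‖w.2‖ ^ 2 + ‖divLp w‖ ^ 2 := by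
  obtain ⟨φ, hφ, hc, hs, -, h2⟩ := hw
  have hcomp : ∀ i, ContDiff ℝ ∞ (fun x => φ x i) := fun i =>
    (EuclideanSpace.proj (𝕜 := ℝ) i).contDiff.comp hφ
  have hcc : ∀ i, HasCompactSupport (fun x => φ x i) := fun i =>
    hc.comp_left (g := fun y : Vec d => y i) (by simp)
  have hG := classicalGrad_apply hφ
  have hzero := fun x => classicalGrad_eq_zero (φ := φ) (x := x)
  have hgc : ∀ i j, Continuous (fun x => classicalGrad φ x (i, j)) := fun i j => by
    simp only [hG]; exact (contDiff_fderiv_apply (hcomp i) _).continuous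
  have hgs : ∀ i j, HasCompactSupport (fun x => classicalGrad φ x (i, j)) := fun i j => by
    simp only [hG]; exact hasCompactSupport_fderiv_apply (hcc i) _
  have hint : ∀ i j k l,
      Integrable (fun x => classicalGrad φ x (i, j) * classicalGrad φ x (k, l)) :=
    fun i j k l => integrable_mul_of_hasCompactSupport (hgc i j) (hgc k l) (hgs i j)
  have e1 : 2 * ‖strainLp w‖ ^ 2 = ∫ x, 2 * ‖symPart (classicalGrad φ x)‖ ^ 2 := by
    rw [norm_sq_eq_integral, ← integral_const_mul,
      ← setIntegral_eq_integral_of_tsupport_subset (φ := φ) hs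
        (fun x hx => by rw [hzero x hx, ← symPartL_apply]; simp)]
    refine integral_congr_ae ?_
    filter_upwards [coeFn_strainLp w, h2] with x h h'
    rw [h, strain, h']
  have e2 : ‖w.2‖ ^ 2 = ∫ x, ‖classicalGrad φ x‖ ^ 2 := by
    rw [norm_sq_eq_integral, ← setIntegral_eq_integral_of_tsupport_subset (φ := φ) hs
        (fun x hx => by rw [hzero x hx]; simp)]
    refine integral_congr_ae ?_
    filter_upwards [h2] with x h'
    rw [h']
  have e3 : ‖divLp w‖ ^ 2 = ∫ x, (∑ i, classicalGrad φ x (i, i)) ^ 2 := by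
    rw [norm_sq_eq_integral, ← setIntegral_eq_integral_of_tsupport_subset (φ := φ) hs
        (fun x hx => by rw [hzero x hx]; simp)]
    refine integral_congr_ae ?_
    filter_upwards [coeFn_divLp w, h2] with x h h'
    rw [h, divg, h', Real.norm_eq_abs, sq_abs]
  have i2 : Integrable (fun x => ‖classicalGrad φ x‖ ^ 2) := by
    simp only [EuclideanSpace.norm_sq_eq, Real.norm_eq_abs, sq_abs]
    refine integrable_finsetSum _ fun ij _ => ?_
    simpa only [pow_two] using hint ij.1 ij.2 ij.1 ij.2
  have i3 : Integrable (fun x => ∑ i, ∑ j,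
      classicalGrad φ x (i, j) * classicalGrad φ x (j, i)) :=
    integrable_finsetSum _ fun i _ => integrable_finsetSum _ fun j _ => hint _ _ _ _
  simp only [two_mul_norm_symPart_sq] at e1
  rw [e1, integral_add i2 i3, e2, e3]
  congr 1
  simp only [pow_two, Finset.sum_mul_sum]
  rw [integral_sum_sum (f := fun i j x => classicalGrad φ x (i, j) * classicalGrad φ x (j, i))
      fun i j => hint i j j i,
    integral_sum_sum (f := fun i j x => classicalGrad φ x (i, i) * classicalGrad φ x (j, j))
      fun i j => hint i i j j]
  -- The products `∂_j φ_i ∂_i φ_j` left over by the symmetric part have, term by term, the same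
  -- integral as the `∂_i φ_i ∂_j φ_j` that make up the squared divergence.
  refine Finset.sum_congr rfl fun i _ => ?_
  refine Finset.sum_congr rfl fun j _ => ?_
  simp only [hG]
  exact integral_fderiv_mul_fderiv_swap (hcomp i) (hcomp j) (hcc i) _ _

theorem two_mul_strainLp_sq {D : Domain d} {w : FieldGrad D} (hw : w ∈ H10 D) :
    2 * ‖strainLp w‖ ^ 2 = ‖w.2‖ ^ 2 + ‖divLp w‖ ^ 2 := by
  have hcl : IsClosed {w : FieldGrad D | 2 * ‖strainLp w‖ ^ 2 = ‖w.2‖ ^ 2 + ‖divLp w‖ ^ 2} :=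
    isClosed_eq (continuous_const.mul (continuous_strainLp.norm.pow 2))
      ((continuous_snd.norm.pow 2).add (continuous_divLp.norm.pow 2))
  exact closure_minimal (fun w => two_mul_strainLp_sq_of_mem_testFields) hcl hw.2

theorem norm_symPart_sq_le (A : Mat d) : ‖symPart A‖ ^ 2 ≤ ‖A‖ ^ 2 := by
  have h := two_mul_norm_symPart_sq A
  have h2 : ∑ i, ∑ j, A (i, j) * A (j, i) ≤ ‖A‖ ^ 2 := by
    have hc : ∑ i, ∑ j, A (j, i) ^ 2 = ∑ i, ∑ j, A (i, j) ^ 2 := Finset.sum_comm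
    have : ∑ i, ∑ j, A (i, j) * A (j, i) ≤
        ∑ i, ∑ j, (A (i, j) ^ 2 / 2 + A (j, i) ^ 2 / 2) := by
      refine Finset.sum_le_sum fun i _ => Finset.sum_le_sum fun j _ => ?_
      nlinarith [sq_nonneg (A (i, j) - A (j, i))]
    simp only [Finset.sum_add_distrib, ← Finset.sum_div, hc] at this
    simp only [EuclideanSpace.norm_sq_eq, Real.norm_eq_abs, sq_abs, Fintype.sum_prod_type]
    linarith
  linarith

theorem norm_strainLp_le {D : Domain d} (w : FieldGrad D) : ‖strainLp w‖ ≤ ‖w.2‖ := by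
  refine Lp.norm_le_norm_of_ae_le ?_
  filter_upwards [coeFn_strainLp w] with x hx
  rw [hx]
  exact (sq_le_sq₀ (norm_nonneg _) (norm_nonneg _)).1 (norm_symPart_sq_le _)

/-- The pointwise trace bound would cost a factor `√d`. On `H¹₀` the identity `‖div w‖² = 2‖ε(w)‖² -
‖∇w‖²` together with `‖ε(w)‖ ≤ ‖∇w‖` gives constant one, which keeps such a factor out of `D₁`. -/
theorem norm_divLp_le {D : Domain d} {w : FieldGrad D} (hw : w ∈ H10 D) :
    ‖divLp w‖ ≤ ‖w.2‖ := by
  refine (sq_le_sq₀ (norm_nonneg _) (norm_nonneg _)).1 ?_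
  have h1 := two_mul_strainLp_sq hw
  have h2 := (sq_le_sq₀ (norm_nonneg _) (norm_nonneg _)).2 (norm_strainLp_le w)
  linarith

theorem exists_isKornConst (D : Domain d) : ∃ cK, IsKornConst D cK := by
  -- The identity `2‖ε‖² = ‖∇w‖² + ‖div w‖²` even gives `√2`; the value `2` avoids the root.
  refine ⟨2, two_pos, fun w hw => ?_⟩
  rw [strainNorm_eq]
  refine (sq_le_sq₀ (norm_nonneg _) (by positivity)).1 ?_
  have h1 := two_mul_strainLp_sq hw
  nlinarith [sq_nonneg ‖divLp w‖, sq_nonneg ‖strainLp w‖]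

theorem norm_le_of_mem_testFields {D : Domain d} {R : ℝ} (hR : 0 < R)
    (hD : ∀ x ∈ D.carrier, ‖x‖ ≤ R) (k : Fin d) {w : FieldGrad D} (hw : w ∈ testFields D) :
    ‖w.1‖ ≤ 2 * R * ‖w.2‖ := by
  obtain ⟨φ, hφ, hc, hs, h1, h2⟩ := hw
  have hcomp : ∀ i, ContDiff ℝ ∞ (fun x => φ x i) := fun i =>
    (EuclideanSpace.proj (𝕜 := ℝ) i).contDiff.comp hφ
  have hcc : ∀ i, HasCompactSupport (fun x => φ x i) := fun i =>
    hc.comp_left (g := fun y : Vec d => y i) (by simp)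
  have hts : ∀ i, tsupport (fun x => φ x i) ⊆ tsupport φ := fun i =>
    closure_mono fun x hx hx0 => hx (by simp [hx0])
  have hG := classicalGrad_apply hφ
  have hzero := fun x => classicalGrad_eq_zero (φ := φ) (x := x)
  have e1 : ‖w.1‖ ^ 2 = ∑ i, ∫ x, φ x i ^ 2 := by
    have hi : ∀ i ∈ Finset.univ, Integrable (fun x => φ x i ^ 2) := fun i _ =>
      ((hcomp i).continuous.pow 2).integrable_of_hasCompactSupport (hasCompactSupport_sq (hcc i))
    rw [norm_sq_eq_integral, ← integral_finsetSum _ hi,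
      ← setIntegral_eq_integral_of_tsupport_subset (φ := φ) hs
        (fun x hx => by simp [image_eq_zero_of_notMem_tsupport hx])]
    refine integral_congr_ae ?_
    filter_upwards [h1] with x h'
    rw [h', EuclideanSpace.norm_sq_eq]
    simp
  have hi : ∀ i j, Integrable (fun x => classicalGrad φ x (i, j) ^ 2) := fun i j => by
    simp only [hG]
    exact ((contDiff_fderiv_apply (hcomp i) _).continuous.pow 2).integrable_of_hasCompactSupport
      (hasCompactSupport_sq (hasCompactSupport_fderiv_apply (hcc i) _))
  have e2 : ‖w.2‖ ^ 2 = ∑ i, ∑ j, ∫ x, classicalGrad φ x (i, j) ^ 2 := by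
    rw [← integral_sum_sum (f := fun i j x => classicalGrad φ x (i, j) ^ 2) hi,
      norm_sq_eq_integral, ← setIntegral_eq_integral_of_tsupport_subset (φ := φ) hs
        (fun x hx => by rw [hzero x hx]; simp)]
    refine integral_congr_ae ?_
    filter_upwards [h2] with x h'
    rw [h', EuclideanSpace.norm_sq_eq, Fintype.sum_prod_type]
    simp
  refine (sq_le_sq₀ (norm_nonneg _) (by positivity)).1 ?_
  rw [e1, mul_pow, e2, Finset.mul_sum]
  refine Finset.sum_le_sum fun i _ => ?_
  have h := integral_sq_le_of_support_bounded (hcomp i) (hcc i)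
    (fun x hx => hD x (hs (hts i hx))) k
  simp only [← hG] at h
  have h3 : ∫ x, classicalGrad φ x (i, k) ^ 2 ≤ ∑ j, ∫ x, classicalGrad φ x (i, j) ^ 2 :=
    Finset.single_le_sum (f := fun j => ∫ x, classicalGrad φ x (i, j) ^ 2)
      (fun j _ => integral_nonneg fun x => sq_nonneg _) (Finset.mem_univ k)
  nlinarith [mul_le_mul_of_nonneg_left h3 (sq_nonneg R)]

theorem exists_isPoincareConst (hd : 0 < d) (D : Domain d) : ∃ cP, IsPoincareConst D cP := by
  obtain ⟨R, hR0, hR⟩ := D.isBounded.exists_pos_norm_le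
  refine ⟨2 * R, by positivity, fun w hw => ?_⟩
  have hcl : IsClosed {w : FieldGrad D | ‖w.1‖ ≤ 2 * R * ‖w.2‖} :=
    isClosed_le continuous_fst.norm (continuous_const.mul continuous_snd.norm)
  exact closure_minimal (fun w => norm_le_of_mem_testFields hR0 hR ⟨0, hd⟩) hcl hw.2

/-! ### The elasticity form -/

/-- The clamped form makes both the bound by `r` and the measurability of the truncation immediate.
-/
theorem trunc_eq_max_min {r : ℝ} (hr : 0 < r) (f : ℝ) : trunc r f = max (-r) (min r f) := by
  unfold trunc
  split_ifs with h
  · rw [min_eq_right (abs_le.1 h).2, max_eq_right (abs_le.1 h).1]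
  · rcases lt_abs.1 (not_le.1 h) with h | h
    · rw [min_eq_left h.le, sign_pos (hr.trans h), max_eq_right (by linarith)]; simp
    · rw [min_eq_right (by linarith), sign_neg (by linarith), max_eq_left (by linarith)]; simp

theorem abs_trunc_le {r : ℝ} (hr : 0 < r) (f : ℝ) : |trunc r f| ≤ r := by
  rw [trunc_eq_max_min hr, abs_le]
  exact ⟨le_max_left _ _, max_le (by linarith) (min_le_left _ _)⟩

theorem measurable_trunc {r : ℝ} (hr : 0 < r) : Measurable (trunc r) := by
  rw [funext (trunc_eq_max_min hr)]
  fun_prop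

theorem aemeasurable_trunc_divg {D : Domain d} {r : ℝ} (hr : 0 < r) (w : FieldGrad D) :
    AEMeasurable (fun x => trunc r (divg w x)) D.μ := by
  have h : AEMeasurable (divg w) D.μ :=
    (Lp.aestronglyMeasurable (divLp w)).aemeasurable.congr (coeFn_divLp w)
  exact (measurable_trunc hr).comp_aemeasurable h

/-- The elasticity form of the displacement equation, linearized at `u'`. -/
def elasticForm {D : Domain d} (c : Coeffs) (u' u z : FieldGrad D) : ℝ :=
  1 / c.E₁ * (∫ x in D.carrier,
      1 / (1 + c.lam₁ * trunc c.δ (divg u' x)) * inner ℝ (strain u x) (strain z x))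
    + |c.E₂| / c.E₁ * (∫ x in D.carrier,
        (1 + c.lam₂ * trunc c.δ (divg u' x)) / (1 + c.lam₁ * trunc c.δ (divg u' x))
          * (1 / c.F d (trunc c.δ (divg u' x))) * divg u x * divg z x)

/-- Passing from pointwise strains and divergences to their `L²` classes makes the weighted-integral
lemmas applicable. -/
theorem elasticForm_eq {D : Domain d} (c : Coeffs) (u' u z : FieldGrad D) :
    elasticForm c u' u z = 1 / c.E₁ * (∫ x in D.carrier,
      1 / (1 + c.lam₁ * trunc c.δ (divg u' x)) * inner ℝ (strainLp u x) (strainLp z x))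
    + |c.E₂| / c.E₁ * (∫ x in D.carrier,
        ((1 + c.lam₂ * trunc c.δ (divg u' x)) / (1 + c.lam₁ * trunc c.δ (divg u' x))
          * (1 / c.F d (trunc c.δ (divg u' x)))) * inner ℝ (divLp u x) (divLp z x)) := by
  unfold elasticForm
  congr 2
  · refine integral_congr_ae ?_
    filter_upwards [coeFn_strainLp u, coeFn_strainLp z] with x h1 h2
    rw [h1, h2]
  · refine integral_congr_ae ?_
    filter_upwards [coeFn_divLp u, coeFn_divLp z] with x h1 h2
    rw [h1, h2]; simp; ring

/-! ### Bounds on the coefficient weights for truncated arguments -/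

namespace Coeffs

variable {c : Coeffs}

theorem Admissible.γ₁_pos (hc : c.Admissible d) : 0 < c.γ₁ := by
  have := hc.δ_pos
  unfold Coeffs.γ₁; positivity

theorem Admissible.γ₂_pos (hc : c.Admissible d) : 0 < c.γ₂ := one_div_pos.2 hc.small₁

theorem Admissible.γ₅_pos (hc : c.Admissible d) : 0 < c.γ₅ d := by
  have h1 := hc.small₃
  have h2 := mul_nonneg (abs_nonneg (c.γ₄ d)) hc.δ_pos.le
  exact one_div_pos.2 (by linarith)

theorem Admissible.γ₆_pos (hc : c.Admissible d) : 0 < c.γ₆ d := one_div_pos.2 hc.small₃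

theorem Admissible.γ₇_pos (hc : c.Admissible d) : 0 < c.γ₇ := hc.small₂

theorem Admissible.γ₈_pos (hc : c.Admissible d) : 0 < c.γ₈ := by
  have := hc.δ_pos
  unfold Coeffs.γ₈; positivity

theorem abs_mul_le_of_abs_le {l δ τ : ℝ} (hτ : |τ| ≤ δ) :
    -(|l| * δ) ≤ l * τ ∧ l * τ ≤ |l| * δ := by
  rw [← abs_le, abs_mul]
  exact mul_le_mul_of_nonneg_left hτ (abs_nonneg l)

theorem Admissible.shear_weight_bounds (hc : c.Admissible d) {τ : ℝ} (hτ : |τ| ≤ c.δ) :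
    c.γ₁ ≤ 1 / (1 + c.lam₁ * τ) ∧ 1 / (1 + c.lam₁ * τ) ≤ c.γ₂ := by
  obtain ⟨h1, h2⟩ := abs_mul_le_of_abs_le (l := c.lam₁) hτ
  have := hc.small₁
  exact ⟨one_div_le_one_div_of_le (by linarith) (by linarith),
    one_div_le_one_div_of_le this (by linarith)⟩

theorem Admissible.one_div_F_bounds (hc : c.Admissible d) {τ : ℝ} (hτ : |τ| ≤ c.δ) :
    c.γ₅ d ≤ 1 / c.F d τ ∧ 1 / c.F d τ ≤ c.γ₆ d := by
  -- Since `E₂ < 0`, `F` is affine with coefficients `γ₃` and `γ₄`, so its extreme values on `|τ| ≤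
  -- δ` are the reciprocals of `γ₅` and `γ₆`.
  have hF : c.F d τ = c.γ₃ d + c.γ₄ d * τ := by
    unfold F γ₃ γ₄
    rw [abs_of_neg hc.E₂_neg]; ring
  obtain ⟨h1, h2⟩ := abs_mul_le_of_abs_le (l := c.γ₄ d) hτ
  have := hc.small₃
  rw [hF]
  exact ⟨one_div_le_one_div_of_le (by linarith) (by linarith),
    one_div_le_one_div_of_le this (by linarith)⟩

theorem Admissible.div_weight_bounds (hc : c.Admissible d) {τ : ℝ} (hτ : |τ| ≤ c.δ) :
    c.γ₇ * c.γ₁ * c.γ₅ d ≤ (1 + c.lam₂ * τ) / (1 + c.lam₁ * τ) * (1 / c.F d τ) ∧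
      (1 + c.lam₂ * τ) / (1 + c.lam₁ * τ) * (1 / c.F d τ) ≤ c.γ₈ * c.γ₂ * c.γ₆ d := by
  obtain ⟨h1, h2⟩ := hc.shear_weight_bounds hτ
  obtain ⟨h3, h4⟩ := hc.one_div_F_bounds hτ
  obtain ⟨h5, h6⟩ := abs_mul_le_of_abs_le (l := c.lam₂) hτ
  have g1 := hc.γ₁_pos
  have g2 := hc.γ₂_pos
  have g5 := hc.γ₅_pos
  have g7 := hc.γ₇_pos
  have g8 := hc.γ₈_pos
  have h7 : c.γ₇ ≤ 1 + c.lam₂ * τ := by unfold Coeffs.γ₇; linarith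
  have h8 : 1 + c.lam₂ * τ ≤ c.γ₈ := by unfold Coeffs.γ₈; linarith
  rw [div_eq_mul_one_div (1 + c.lam₂ * τ)]
  have p1 := g1.trans_le h1
  have p7 := g7.trans_le h7
  have p5 := g5.trans_le h3
  constructor <;> gcongr

end Coeffs

open Coeffs

theorem abs_elasticForm_le {D : Domain d} {c : Coeffs} (hc : c.Admissible d)
    (u' u z : FieldGrad D) :
    |elasticForm c u' u z| ≤ c.γ₂ / c.E₁ * (‖strainLp u‖ * ‖strainLp z‖)
      + |c.E₂| / c.E₁ * (c.γ₈ * c.γ₂ * c.γ₆ d) * (‖divLp u‖ * ‖divLp z‖) := by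
  have hE := hc.E₁_pos
  have g1 := hc.γ₁_pos
  have g2 := hc.γ₂_pos
  have g5 := hc.γ₅_pos
  have g6 := hc.γ₆_pos
  have g7 := hc.γ₇_pos
  have g8 := hc.γ₈_pos
  have h1 := abs_integral_weight_inner_le (μ := D.μ)
    (a := fun x => 1 / (1 + c.lam₁ * trunc c.δ (divg u' x))) g2.le
    (ae_of_all _ fun x => by
      obtain ⟨h, h'⟩ := hc.shear_weight_bounds (abs_trunc_le hc.δ_pos (divg u' x))
      exact abs_le.2 ⟨by linarith, h'⟩) (strainLp u) (strainLp z)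
  have h2 := abs_integral_weight_inner_le (μ := D.μ)
    (a := fun x => (1 + c.lam₂ * trunc c.δ (divg u' x)) / (1 + c.lam₁ * trunc c.δ (divg u' x))
          * (1 / c.F d (trunc c.δ (divg u' x)))) (M := c.γ₈ * c.γ₂ * c.γ₆ d) (by positivity)
    (ae_of_all _ fun x => by
      obtain ⟨h, h'⟩ := hc.div_weight_bounds (abs_trunc_le hc.δ_pos (divg u' x))
      have p1 : 0 < c.γ₇ * c.γ₁ * c.γ₅ d := by positivity
      have p2 : 0 < c.γ₈ * c.γ₂ * c.γ₆ d := by positivity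
      exact abs_le.2 ⟨by linarith, h'⟩) (divLp u) (divLp z)
  rw [elasticForm_eq]
  refine (abs_add_le _ _).trans ?_
  rw [abs_mul, abs_mul, abs_of_pos (one_div_pos.2 hE), abs_of_nonneg (by positivity :
    0 ≤ |c.E₂| / c.E₁)]
  refine add_le_add ?_ ?_
  · refine (mul_le_mul_of_nonneg_left h1 (by positivity)).trans (le_of_eq ?_)
    ring
  · refine (mul_le_mul_of_nonneg_left h2 (by positivity)).trans (le_of_eq ?_)
    ring

theorem le_elasticForm_self {D : Domain d} {c : Coeffs} (hc : c.Admissible d)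
    (u' u : FieldGrad D) :
    c.γ₁ / c.E₁ * ‖strainLp u‖ ^ 2
      + |c.E₂| / c.E₁ * (c.γ₇ * c.γ₁ * c.γ₅ d) * ‖divLp u‖ ^ 2 ≤ elasticForm c u' u u := by
  have hE := hc.E₁_pos
  have g1 := hc.γ₁_pos
  have g2 := hc.γ₂_pos
  have g5 := hc.γ₅_pos
  have g6 := hc.γ₆_pos
  have g7 := hc.γ₇_pos
  have g8 := hc.γ₈_pos
  have hm := aemeasurable_trunc_divg hc.δ_pos u'
  have h1 := le_integral_weight_inner_self (μ := D.μ)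
    (a := fun x => 1 / (1 + c.lam₁ * trunc c.δ (divg u' x))) (m := c.γ₁) (M := c.γ₂)
    (AEMeasurable.aestronglyMeasurable (by fun_prop))
    (ae_of_all _ fun x => (hc.shear_weight_bounds (abs_trunc_le hc.δ_pos (divg u' x))).1)
    (ae_of_all _ fun x => by
      obtain ⟨h, h'⟩ := hc.shear_weight_bounds (abs_trunc_le hc.δ_pos (divg u' x))
      exact abs_le.2 ⟨by linarith, h'⟩) (strainLp u)
  have h2 := le_integral_weight_inner_self (μ := D.μ)
    (a := fun x => (1 + c.lam₂ * trunc c.δ (divg u' x)) / (1 + c.lam₁ * trunc c.δ (divg u' x))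
          * (1 / c.F d (trunc c.δ (divg u' x)))) (M := c.γ₈ * c.γ₂ * c.γ₆ d)
    (AEMeasurable.aestronglyMeasurable (by unfold Coeffs.F; fun_prop))
    (ae_of_all _ fun x => (hc.div_weight_bounds (abs_trunc_le hc.δ_pos (divg u' x))).1)
    (ae_of_all _ fun x => by
      obtain ⟨h, h'⟩ := hc.div_weight_bounds (abs_trunc_le hc.δ_pos (divg u' x))
      have p1 : 0 < c.γ₇ * c.γ₁ * c.γ₅ d := by positivity
      have p2 : 0 < c.γ₈ * c.γ₂ * c.γ₆ d := by positivity
      exact abs_le.2 ⟨by linarith, h'⟩) (divLp u)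
  rw [elasticForm_eq]
  refine add_le_add ?_ ?_
  · refine le_trans (le_of_eq ?_) (mul_le_mul_of_nonneg_left h1 (by positivity))
    ring
  · refine le_trans (le_of_eq ?_) (mul_le_mul_of_nonneg_left h2 (by positivity))
    ring

/-! ### The energy estimate -/

/-- Cauchy–Schwarz for two terms with weights `s`, `s'`: the cross term satisfies `(2xy)² ≤ 4 (s
t')(s' t) ≤ (s t' + s' t)²`. -/
theorem sq_add_le_mul_of_sq_le {x y s s' t t' : ℝ} (hs : 0 ≤ s) (hs' : 0 ≤ s') (ht : 0 ≤ t)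
    (ht' : 0 ≤ t') (hx : x ^ 2 ≤ s * t) (hy : y ^ 2 ≤ s' * t') :
    (x + y) ^ 2 ≤ (s + s') * (t + t') := by
  have h : 2 * (x * y) ≤ s * t' + s' * t := by
    refine le_of_abs_le (abs_le_of_sq_le_sq ?_ (by positivity))
    have := mul_le_mul hx hy (sq_nonneg y) (by positivity)
    nlinarith [sq_nonneg (s * t' - s' * t)]
  nlinarith

theorem two_mul_inner_sub_self {E : Type*} [NormedAddCommGroup E] [InnerProductSpace ℝ E]
    (a b : E) : 2 * inner ℝ (a - b) a = ‖a‖ ^ 2 - ‖b‖ ^ 2 + ‖a - b‖ ^ 2 := by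
  have h := norm_sub_sq_real a (a - b)
  rw [sub_sub_cancel, real_inner_comm] at h
  linarith

/-- The quadratic dissipation of the displacement equation. -/
def elasticDissipation {D : Domain d} (c : Coeffs) (u : FieldGrad D) : ℝ :=
  c.γ₁ / (c.α * c.E₁) * ‖strainLp u‖ ^ 2
    + 2 * (|c.E₂| * (c.γ₇ * c.γ₁ * c.γ₅ d)) / (c.α * c.E₁) * ‖divLp u‖ ^ 2

theorem elasticDissipation_nonneg {D : Domain d} {c : Coeffs} (hc : c.Admissible d)
    (u : FieldGrad D) : 0 ≤ elasticDissipation c u := by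
  have hE := hc.E₁_pos
  have hα := hc.α_pos
  have g1 := hc.γ₁_pos
  have g5 := hc.γ₅_pos
  have g7 := hc.γ₇_pos
  unfold elasticDissipation
  positivity

/-- Test with `z = u` and multiply by `2 dt / α`. Young's inequality against the load `(v, u)`,
bounded through Poincaré and Korn, uses up half of the strain dissipation. The divergence part is
untouched, which explains the factor 2 that only the second term of `elasticDissipation` carries. -/
theorem displacement_energy {D : Domain d} {c : Coeffs} (hc : c.Admissible d) {dt cP cK : ℝ}
    (hdt : 0 < dt) (hP : IsPoincareConst D cP) (hK : IsKornConst D cK)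
    {Uh : Submodule ℝ (FieldGrad D)} (hUh : (Uh : Set (FieldGrad D)) ⊆ H10 D)
    {u' u v : FieldGrad D} (hu : u ∈ Uh) (h : DisplacementStep c dt Uh u' u v) :
    ‖u.1‖ ^ 2 - ‖u'.1‖ ^ 2 + (‖u.1 - u'.1‖ ^ 2 + dt * elasticDissipation c u)
      ≤ c.E₁ * c.α * (cP * cK) ^ 2 / c.γ₁ * (dt * ‖v.1‖ ^ 2) := by
  have hE := hc.E₁_pos
  have hα := hc.α_pos
  have g1 := hc.γ₁_pos
  have h0 : c.α / dt * inner ℝ (u.1 - u'.1) u.1 + elasticForm c u' u u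
      = c.α * inner ℝ v.1 u.1 := by rw [← h u hu, elasticForm, add_assoc]
  have hco := le_elasticForm_self hc u' u
  have hin : inner ℝ v.1 u.1 ≤ ‖v.1‖ * (cP * cK * ‖strainLp u‖) := by
    refine (real_inner_le_norm _ _).trans (mul_le_mul_of_nonneg_left ?_ (norm_nonneg _))
    rw [mul_assoc, ← strainNorm_eq]
    exact (hP.2 u (hUh hu)).trans (mul_le_mul_of_nonneg_left (hK.2 u (hUh hu)) hP.1.le)
  have hpol := two_mul_inner_sub_self u.1 u'.1
  have hy : 2 * (‖v.1‖ * (cP * cK * ‖strainLp u‖)) ≤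
      c.γ₁ / (c.α * c.E₁) * ‖strainLp u‖ ^ 2
        + c.E₁ * c.α * (cP * cK) ^ 2 / c.γ₁ * ‖v.1‖ ^ 2 := by
    have : c.γ₁ / (c.α * c.E₁) * ‖strainLp u‖ ^ 2
        + c.E₁ * c.α * (cP * cK) ^ 2 / c.γ₁ * ‖v.1‖ ^ 2
        - 2 * (‖v.1‖ * (cP * cK * ‖strainLp u‖)) =
        c.γ₁ / (c.α * c.E₁)
          * (‖strainLp u‖ - c.E₁ * c.α * (cP * cK) / c.γ₁ * ‖v.1‖) ^ 2 := by
      field_simp; ring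
    have : 0 ≤ c.γ₁ / (c.α * c.E₁)
          * (‖strainLp u‖ - c.E₁ * c.α * (cP * cK) / c.γ₁ * ‖v.1‖) ^ 2 := by positivity
    linarith
  have h1 : 2 * inner ℝ (u.1 - u'.1) u.1 + 2 * dt / c.α * elasticForm c u' u u =
      2 * dt * inner ℝ v.1 u.1 := by
    have : 2 * dt / c.α * (c.α / dt * inner ℝ (u.1 - u'.1) u.1 + elasticForm c u' u u) =
        2 * dt / c.α * (c.α * inner ℝ v.1 u.1) := by rw [h0]
    field_simp at this ⊢
    linarith
  have h2 : 2 * dt / c.α * (c.γ₁ / c.E₁ * ‖strainLp u‖ ^ 2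
      + |c.E₂| / c.E₁ * (c.γ₇ * c.γ₁ * c.γ₅ d) * ‖divLp u‖ ^ 2) =
      dt * elasticDissipation c u + dt * (c.γ₁ / (c.α * c.E₁) * ‖strainLp u‖ ^ 2) := by
    unfold elasticDissipation
    field_simp; ring
  have h3 := mul_le_mul_of_nonneg_left hco (by positivity : 0 ≤ 2 * dt / c.α)
  have h4 := mul_le_mul_of_nonneg_left hy hdt.le
  have h5 := mul_le_mul_of_nonneg_left hin (by positivity : 0 ≤ 2 * dt)
  linarith

/-- Weighted Cauchy–Schwarz between the upper bounds of the elastic form and the dissipation. The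
weights are the ratios of squared upper bound to dissipation coefficient, namely `1` and `D₁ / 2` up
to a common factor, and they sum to `D₂`. -/
theorem elastic_load_sq_le {D : Domain d} {c : Coeffs} (hc : c.Admissible d) (u : FieldGrad D) :
    (c.γ₂ / c.E₁ * ‖strainLp u‖ + |c.E₂| / c.E₁ * (c.γ₈ * c.γ₂ * c.γ₆ d) * ‖divLp u‖) ^ 2
      ≤ c.α / c.E₁ * (c.γ₂ ^ 2 / c.γ₁) * c.D₂ d * elasticDissipation c u := by
  have hE := hc.E₁_pos
  have hE₂ : 0 < |c.E₂| := abs_pos.2 hc.E₂_neg.ne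
  have hα := hc.α_pos
  have g1 := hc.γ₁_pos
  have g2 := hc.γ₂_pos
  have g5 := hc.γ₅_pos
  have g6 := hc.γ₆_pos
  have g7 := hc.γ₇_pos
  have g8 := hc.γ₈_pos
  have h := sq_add_le_mul_of_sq_le (x := c.γ₂ / c.E₁ * ‖strainLp u‖)
    (y := |c.E₂| / c.E₁ * (c.γ₈ * c.γ₂ * c.γ₆ d) * ‖divLp u‖)
    (s := c.α / c.E₁ * (c.γ₂ ^ 2 / c.γ₁)) (s' := c.α / c.E₁ * (c.γ₂ ^ 2 / c.γ₁) * (c.D₁ d / 2))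
    (t := c.γ₁ / (c.α * c.E₁) * ‖strainLp u‖ ^ 2)
    (t' := 2 * (|c.E₂| * (c.γ₇ * c.γ₁ * c.γ₅ d)) / (c.α * c.E₁) * ‖divLp u‖ ^ 2)
    (by positivity) (by unfold Coeffs.D₁; positivity) (by positivity) (by positivity)
    (by apply le_of_eq; field_simp) (by apply le_of_eq; unfold Coeffs.D₁; field_simp)
  refine h.trans (le_of_eq ?_)
  unfold elasticDissipation Coeffs.D₂
  ring

theorem Coeffs.Admissible.D₂_pos {c : Coeffs} (hc : c.Admissible d) : 0 < c.D₂ d := by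
  have g5 := hc.γ₅_pos
  have g7 := hc.γ₇_pos
  unfold D₂ D₁
  positivity

theorem Coeffs.Admissible.D₃_pos {c : Coeffs} (hc : c.Admissible d) {h dt : ℝ} (hdt : 0 < dt) :
    0 < c.D₃ d h dt := by
  have hE := hc.E₁_pos
  have hα := hc.α_pos
  have g1 := hc.γ₁_pos
  have g2 := hc.γ₂_pos
  have := hc.D₂_pos
  unfold D₃
  positivity

theorem young_three_terms {ν : ℝ} (hν : 0 < ν) (C X a1 a2 b : ℝ) : C * X * (a1 + a2 + b) ≤
    ν / 2 * X ^ 2 + 3 * C ^ 2 / (2 * ν) * (a1 ^ 2 + a2 ^ 2 + b ^ 2) := by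
  have q1 : 0 ≤ ν / 2 * (X - C / ν * (a1 + a2 + b)) ^ 2 := by positivity
  have q2 : ν / 2 * (X - C / ν * (a1 + a2 + b)) ^ 2 = ν / 2 * X ^ 2
      - C * X * (a1 + a2 + b) + C ^ 2 / (2 * ν) * (a1 + a2 + b) ^ 2 := by
    field_simp; ring
  -- Three sources (interpolation error, drag, elasticity) produce the factor 3 found in `C₁` and
  -- `C₂`.
  have q3 : (a1 + a2 + b) ^ 2 ≤ 3 * (a1 ^ 2 + a2 ^ 2 + b ^ 2) := by
    nlinarith [sq_nonneg (a1 - a2), sq_nonneg (a1 - b), sq_nonneg (a2 - b)]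
  have q4 := mul_le_mul_of_nonneg_left q3 (by positivity : 0 ≤ C ^ 2 / (2 * ν))
  have q5 : C ^ 2 / (2 * ν) * (3 * (a1 ^ 2 + a2 ^ 2 + b ^ 2)) =
    3 * C ^ 2 / (2 * ν) * (a1 ^ 2 + a2 ^ 2 + b ^ 2) := by ring
  linarith

theorem fluid_energy {D : Domain d} {c : Coeffs} (hc : c.Admissible d) {dt h C cP : ℝ}
    (hdt : 0 < dt) (hh : 0 < h) (hC : 0 < C) (hP : IsPoincareConst D cP)
    {Uh Xh : Submodule ℝ (FieldGrad D)} {Qh : Submodule ℝ (L20 D)}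
    (hUh : (Uh : Set (FieldGrad D)) ⊆ H10 D) (hXh : (Xh : Set (FieldGrad D)) ⊆ H10 D)
    {Pih : FieldGrad D → FieldGrad D} (hPih : IsStableInterp Uh h C Pih)
    {u' u v' v : FieldGrad D} {p : L20 D} (hv : v ∈ discreteDivFree Xh Qh) (hp : p ∈ Qh)
    (hD : DisplacementStep c dt Uh u' u v) (hF : FluidStep c dt Xh u' u v' v p) :
    ‖v.1‖ ^ 2 - ‖v'.1‖ ^ 2
        + dt * (c.ν / c.ρ * ‖v.2‖ ^ 2 + 2 * c.α / c.ρ * ‖v.1‖ ^ 2)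
      ≤ 3 * C ^ 2 / (c.ν * c.ρ) *
        (c.D₃ d h dt * (‖u.1 - u'.1‖ ^ 2 + dt * elasticDissipation c u)
          + (c.α * cP) ^ 2 * (dt * ‖v.1‖ ^ 2)) := by
  have hE := hc.E₁_pos
  have hα := hc.α_pos
  have hν := hc.ν_pos
  have hρ := hc.ρ_pos
  have g1 := hc.γ₁_pos
  have g2 := hc.γ₂_pos
  have g6 := hc.γ₆_pos
  have g8 := hc.γ₈_pos
  have hP0 := hP.1
  have hvH : v ∈ H10 D := hXh hv.1
  obtain ⟨hz, hz2, hz1⟩ := hPih v hvH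
  have hzH : Pih v ∈ H10 D := hUh hz
  set z := Pih v with hzdef
  set X := ‖v.2‖ with hX
  set b := c.γ₂ / c.E₁ * ‖strainLp u‖
    + |c.E₂| / c.E₁ * (c.γ₈ * c.γ₂ * c.γ₆ d) * ‖divLp u‖ with hb
  have hb0 : 0 ≤ b := by positivity
  have e1 : c.α / dt * inner ℝ (u.1 - u'.1) z.1 + elasticForm c u' u z = c.α * inner ℝ v.1 z.1 := by
    rw [← hD z hz, elasticForm, add_assoc]
  have e2 := hF v hv.1
  -- The pressure disappears because `v` is discretely divergence-free and `p` lies in `Qh`.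
  rw [hv.2 p hp, real_inner_self_eq_norm_sq, real_inner_self_eq_norm_sq] at e2
  have b1 : inner ℝ (u.1 - u'.1) (v.1 - z.1) ≤ ‖u.1 - u'.1‖ * (C * h * X) :=
    (real_inner_le_norm _ _).trans (mul_le_mul_of_nonneg_left hz1 (norm_nonneg _))
  have b2 : inner ℝ v.1 z.1 ≤ ‖v.1‖ * (cP * (C * X)) :=
    (real_inner_le_norm _ _).trans (mul_le_mul_of_nonneg_left
      ((hP.2 z hzH).trans (mul_le_mul_of_nonneg_left hz2 hP0.le)) (norm_nonneg _))
  have b3 : -elasticForm c u' u z ≤ b * (C * X) := by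
    refine (neg_le_abs _).trans ((abs_elasticForm_le hc u' u z).trans ?_)
    have s1 := (norm_strainLp_le z).trans hz2
    have s2 := (norm_divLp_le hzH).trans hz2
    rw [hb, add_mul]
    refine add_le_add ?_ ?_
    · rw [mul_assoc]
      exact mul_le_mul_of_nonneg_left
        (mul_le_mul_of_nonneg_left s1 (norm_nonneg _)) (by positivity)
    · rw [mul_assoc _ ‖divLp u‖ (C * X)]
      exact mul_le_mul_of_nonneg_left
        (mul_le_mul_of_nonneg_left s2 (norm_nonneg _)) (by positivity)
  rw [inner_sub_right] at b1
  have hpol := two_mul_inner_sub_self v.1 v'.1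
  set a1 := c.α * h / dt * ‖u.1 - u'.1‖ with ha1
  set a2 := c.α * cP * ‖v.1‖ with ha2
  -- Here `v = (v - z) + z` with `z = Π_h v`: the bound `b1` treats the first part, and `e1`
  -- rewrites the second as drag minus the elastic form.
  have r1 : c.α / dt * inner ℝ (u.1 - u'.1) v.1 ≤ C * X * (a1 + a2 + b) := by
    have t1 := mul_le_mul_of_nonneg_left b1 (by positivity : 0 ≤ c.α / dt)
    have t2 := mul_le_mul_of_nonneg_left b2 hα.le
    have t3 : C * X * (a1 + a2 + b) = c.α / dt * (‖u.1 - u'.1‖ * (C * h * X))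
      + c.α * (‖v.1‖ * (cP * (C * X))) + b * (C * X) := by
      rw [ha1, ha2]; ring
    rw [t3]
    linarith
  have r2 : C * X * (a1 + a2 + b) ≤
      c.ν / 2 * X ^ 2 + 3 * C ^ 2 / (2 * c.ν) * (a1 ^ 2 + a2 ^ 2 + b ^ 2) :=
    young_three_terms hν C X a1 a2 b
  have r3 : ‖v.1‖ ^ 2 - ‖v'.1‖ ^ 2 + ‖v.1 - v'.1‖ ^ 2
      + dt * (c.ν / c.ρ * X ^ 2 + 2 * c.α / c.ρ * ‖v.1‖ ^ 2) ≤
      3 * C ^ 2 / (c.ν * c.ρ) * (dt * (a1 ^ 2 + a2 ^ 2 + b ^ 2)) := by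
    have q1 : c.ρ / dt * inner ℝ (v.1 - v'.1) v.1 + c.ν / 2 * X ^ 2 + c.α * ‖v.1‖ ^ 2 ≤
        3 * C ^ 2 / (2 * c.ν) * (a1 ^ 2 + a2 ^ 2 + b ^ 2) := by linarith
    have q2 := mul_le_mul_of_nonneg_left q1 (by positivity : 0 ≤ 2 * dt / c.ρ)
    have q3 : 2 * dt / c.ρ * (c.ρ / dt * inner ℝ (v.1 - v'.1) v.1 + c.ν / 2 * X ^ 2
        + c.α * ‖v.1‖ ^ 2) = 2 * inner ℝ (v.1 - v'.1) v.1
        + dt * (c.ν / c.ρ * X ^ 2 + 2 * c.α / c.ρ * ‖v.1‖ ^ 2) := by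
      field_simp
      ring
    have q4 : 2 * dt / c.ρ * (3 * C ^ 2 / (2 * c.ν) * (a1 ^ 2 + a2 ^ 2 + b ^ 2)) =
        3 * C ^ 2 / (c.ν * c.ρ) * (dt * (a1 ^ 2 + a2 ^ 2 + b ^ 2)) := by
      field_simp
    linarith
  have r4 : dt * (a1 ^ 2 + a2 ^ 2 + b ^ 2) ≤
      c.D₃ d h dt * (‖u.1 - u'.1‖ ^ 2 + dt * elasticDissipation c u)
          + (c.α * cP) ^ 2 * (dt * ‖v.1‖ ^ 2) := by
    have q1 : b ^ 2 ≤ _ := elastic_load_sq_le hc u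
    have q2 := mul_le_mul_of_nonneg_left q1 hdt.le
    have q3 : dt * a1 ^ 2 = (c.α * h) ^ 2 / dt * ‖u.1 - u'.1‖ ^ 2 := by
      rw [ha1]; field_simp
    -- `D₃` is the sum of the two coefficients rather than their maximum, so two nonnegative cross
    -- terms, `q5` and `q6`, are added for free.
    have q4 := elasticDissipation_nonneg hc u
    have q5 : 0 ≤ (c.α * h) ^ 2 / dt * (dt * elasticDissipation c u) := by positivity
    have q6 : 0 ≤ c.α / c.E₁ * (c.γ₂ ^ 2 / c.γ₁) * c.D₂ d * ‖u.1 - u'.1‖ ^ 2 := by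
      have := hc.D₂_pos
      positivity
    unfold Coeffs.D₃
    have q7 : dt * a2 ^ 2 = (c.α * cP) ^ 2 * (dt * ‖v.1‖ ^ 2) := by rw [ha2]; ring
    linarith
  have r5 := mul_le_mul_of_nonneg_left r4 (by positivity : 0 ≤ 3 * C ^ 2 / (c.ν * c.ρ))
  have := sq_nonneg ‖v.1 - v'.1‖
  linarith

/-- The right-hand side is taken at the new time level, so it is absorbed on the left with factor `1
- τ`. The loss per step is at most `exp (2τ)`, since `(1 - τ)(1 + 2τ) ≥ 1` for `0 ≤ τ ≤ 1/2`. -/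
theorem discrete_gronwall {x z S : ℕ → ℝ} {τ : ℝ} {N : ℕ} (hτ : 0 ≤ τ) (hτ' : τ ≤ 1 / 2)
    (hx : ∀ n, x n ≤ z n) (hS : ∀ n, 0 ≤ S n) (hz : ∀ n, 0 ≤ z n)
    (h : ∀ n < N, z (n + 1) - z n + S (n + 1) ≤ τ * x (n + 1)) :
    ∀ m ≤ N, z m + ∑ i ∈ Finset.range m, S (i + 1) ≤ z 0 * Real.exp (2 * τ * m) := by
  intro m
  induction m with
  | zero => simp
  | succ m ih =>
    intro hm
    have h1 := ih (by omega)
    have h2 := h m (by omega)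
    have hsum : 0 ≤ ∑ i ∈ Finset.range m, S (i + 1) := Finset.sum_nonneg fun i _ => hS _
    rw [Finset.sum_range_succ]
    have h3 : τ * x (m + 1) ≤
        τ * (z (m + 1) + (∑ i ∈ Finset.range m, S (i + 1) + S (m + 1))) := by
      refine mul_le_mul_of_nonneg_left ?_ hτ
      linarith [hx (m + 1), hS (m + 1)]
    set A := z (m + 1) + (∑ i ∈ Finset.range m, S (i + 1) + S (m + 1)) with hA
    have h4 : (1 - τ) * A ≤ z 0 * Real.exp (2 * τ * m) := by linarith
    have h5 : 1 ≤ (1 - τ) * Real.exp (2 * τ) := by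
      nlinarith [Real.add_one_le_exp (2 * τ), mul_nonneg hτ (sub_nonneg.2 hτ')]
    have hA0 : 0 ≤ A := by linarith [hz (m + 1), hS (m + 1)]
    calc A ≤ (1 - τ) * Real.exp (2 * τ) * A := le_mul_of_one_le_left hA0 h5
      _ = Real.exp (2 * τ) * ((1 - τ) * A) := by ring
      _ ≤ Real.exp (2 * τ) * (z 0 * Real.exp (2 * τ * m)) :=
          mul_le_mul_of_nonneg_left h4 (Real.exp_pos _).le
      _ = z 0 * Real.exp (2 * τ * (m + 1 : ℕ)) := by
          rw [mul_left_comm, ← Real.exp_add]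
          congr 2; push_cast; ring

section Scheme

variable {D : Domain d} {c : Coeffs} {T h C β cP cK : ℝ} {N : ℕ}
  {Uh Xh : Submodule ℝ (FieldGrad D)} {Qh : Submodule ℝ (L20 D)}
  {Pih : FieldGrad D → FieldGrad D} {u v : ℕ → FieldGrad D} {p : ℕ → L20 D}

theorem IsDiscreteSolution.energy_bound (hc : c.Admissible d) (hT : 0 < T) (hN : 0 < N)
    (hh : 0 < h) (hC : 0 < C)
    (hUh : (Uh : Set (FieldGrad D)) ⊆ H10 D) (hXh : (Xh : Set (FieldGrad D)) ⊆ H10 D)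
    (hPih : IsStableInterp Uh h C Pih) (hsol : IsDiscreteSolution c (T / N) N Uh Xh Qh u v p)
    (hP : IsPoincareConst D cP) (hK : IsKornConst D cK)
    (hstep : 6 * (C ^ 2 * c.D₄ d h (T / N) cP cK / (c.ν * c.ρ)) * (T / N) ≤ 1)
    {m : ℕ} (hm : m ≤ N) :
    ‖(v m).1‖ ^ 2 + T / N * ∑ i ∈ Finset.range m,
        (c.ν / c.ρ * ‖(v (i + 1)).2‖ ^ 2 + 2 * c.α / c.ρ * ‖(v (i + 1)).1‖ ^ 2)
      ≤ c.C₁ d h (T / N) C ‖(u 0).1‖ ‖(v 0).1‖ * Real.exp (c.C₂ d h (T / N) C cP cK * T) := by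
  have hN' : (0 : ℝ) < N := Nat.cast_pos.2 hN
  have hdt : 0 < T / N := div_pos hT hN'
  set dt := T / N with hdtdef
  have hE := hc.E₁_pos
  have hα := hc.α_pos
  have hν := hc.ν_pos
  have hρ := hc.ρ_pos
  have g1 := hc.γ₁_pos
  have hD₃ := hc.D₃_pos (h := h) hdt
  set L := 3 * C ^ 2 / (c.ν * c.ρ) with hL
  have hL0 : 0 < L := by positivity
  have hD₄ : 0 ≤ c.D₄ d h dt cP cK := by unfold Coeffs.D₄; positivity
  set S : ℕ → ℝ := fun n =>
    dt * (c.ν / c.ρ * ‖(v n).2‖ ^ 2 + 2 * c.α / c.ρ * ‖(v n).1‖ ^ 2) with hSdef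
  -- The weight `L * D₃` is chosen so that the displacement estimate cancels the increment and
  -- dissipation terms on the right of the fluid estimate. What remains is exactly `L * D₄ * dt *
  -- ‖v‖²`, and the step condition says `2τ ≤ 1`.
  have hgr := discrete_gronwall (x := fun n => ‖(v n).1‖ ^ 2)
    (z := fun n => ‖(v n).1‖ ^ 2 + L * c.D₃ d h dt * ‖(u n).1‖ ^ 2) (S := S)
    (τ := L * c.D₄ d h dt cP cK * dt) (N := N) (by positivity)
    (by
      have : 6 * (C ^ 2 * c.D₄ d h dt cP cK / (c.ν * c.ρ)) * dt =
        2 * (L * c.D₄ d h dt cP cK * dt) := by rw [hL]; ring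
      linarith)
    (fun n => le_add_of_nonneg_right (by positivity)) (fun n => by simp only [hSdef]; positivity)
    (fun n => by positivity)
    (by
      intro n hn
      have q1 := displacement_energy hc hdt hP hK hUh (hsol.u_mem (n + 1) (by omega))
        (hsol.displacement (n + 1) (by omega) (by omega))
      have q2 := fluid_energy hc hdt hh hC hP hUh hXh hPih (hsol.v_mem (n + 1) (by omega))
        (hsol.p_mem (n + 1) (by omega) (by omega))
        (hsol.displacement (n + 1) (by omega) (by omega))
        (hsol.fluid (n + 1) (by omega) (by omega))
      rw [Nat.add_sub_cancel] at q1 q2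
      have q3 := mul_le_mul_of_nonneg_left q1 (by positivity : 0 ≤ L * c.D₃ d h dt)
      have q4 : L * c.D₄ d h dt cP cK * dt * ‖(v (n + 1)).1‖ ^ 2 =
          L * ((c.α * cP) ^ 2 * (dt * ‖(v (n + 1)).1‖ ^ 2)) + L * c.D₃ d h dt *
          (c.E₁ * c.α * (cP * cK) ^ 2 / c.γ₁ * (dt * ‖(v (n + 1)).1‖ ^ 2)) := by
        unfold Coeffs.D₄
        field_simp
      simp only [hSdef]
      linarith) m hm
  have hz0 : ‖(v 0).1‖ ^ 2 + L * c.D₃ d h dt * ‖(u 0).1‖ ^ 2 =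
      c.C₁ d h dt C ‖(u 0).1‖ ‖(v 0).1‖ := by
    rw [hL]; unfold Coeffs.C₁; ring
  have hC₁ : 0 ≤ c.C₁ d h dt C ‖(u 0).1‖ ‖(v 0).1‖ := by rw [← hz0]; positivity
  rw [hz0, ← Finset.mul_sum] at hgr
  have hexp : 2 * (L * c.D₄ d h dt cP cK * dt) * m ≤ c.C₂ d h dt C cP cK * T := by
    have q1 : dt * m ≤ T := by
      rw [hdtdef, div_mul_eq_mul_div, div_le_iff₀ hN']
      exact mul_le_mul_of_nonneg_left (by exact_mod_cast hm) hT.le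
    -- Gronwall needs only the rate `2 * L * D₄`; the constant `C₂` leaves room to spare.
    have q2 : c.C₂ d h dt C cP cK = 3 * (L * c.D₄ d h dt cP cK) := by
      rw [hL]; unfold Coeffs.C₂; ring
    have q3 : 0 ≤ L * c.D₄ d h dt cP cK := by positivity
    rw [q2]
    nlinarith [mul_le_mul_of_nonneg_left q1 q3, mul_nonneg q3 hT.le]
  have h1 := mul_le_mul_of_nonneg_left (Real.exp_le_exp.2 hexp) hC₁
  have h2 : 0 ≤ L * c.D₃ d h dt * ‖(u m).1‖ ^ 2 := by positivity
  linarith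

theorem IsDiscreteSolution.norm_displacement_sq_le (hc : c.Admissible d) (hT : 0 < T)
    (hN : 0 < N) (hUh : (Uh : Set (FieldGrad D)) ⊆ H10 D)
    (hsol : IsDiscreteSolution c (T / N) N Uh Xh Qh u v p)
    (hP : IsPoincareConst D cP) (hK : IsKornConst D cK) {m : ℕ} (hm : m ≤ N) :
    ‖(u m).1‖ ^ 2 ≤ ‖(u 0).1‖ ^ 2 + c.E₁ * c.α * (cP * cK) ^ 2 / c.γ₁ *
      (T / N * ∑ i ∈ Finset.range m, ‖(v (i + 1)).1‖ ^ 2) := by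
  have hdt : 0 < T / N := div_pos hT (Nat.cast_pos.2 hN)
  induction m with
  | zero => simp
  | succ m ih =>
    have q1 := displacement_energy hc hdt hP hK hUh (hsol.u_mem (m + 1) hm)
        (hsol.displacement (m + 1) (by omega) hm)
    rw [Nat.add_sub_cancel] at q1
    have q2 := elasticDissipation_nonneg hc (u (m + 1))
    have q3 := ih (by omega)
    have q4 := mul_nonneg hdt.le q2
    have q5 := sq_nonneg ‖(u (m + 1)).1 - (u m).1‖
    rw [Finset.sum_range_succ, mul_add, mul_add]
    linarith

end Scheme

/-! ### The bound on the time integral of the pressure -/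

theorem mul_norm_le_of_le_discreteInfSup {D : Domain d} {β K : ℝ}
    {Xh : Submodule ℝ (FieldGrad D)} {Qh : Submodule ℝ (L20 D)}
    (hβ : (β : EReal) ≤ discreteInfSup Xh Qh) (hK : 0 ≤ K) {q : L20 D} (hq : q ∈ Qh)
    (h : ∀ w ∈ Xh, divForm q w ≤ K * ‖w.2‖) : β * ‖q‖ ≤ K := by
  rcases eq_or_ne q 0 with rfl | hq0
  · simpa using hK
  have hn : 0 < ‖q‖ := norm_pos_iff.2 hq0
  have h1 : (β : EReal) ≤ ((K / ‖q‖ : ℝ) : EReal) := by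
    refine (hβ.trans (iInf₂_le q ⟨hq, hq0⟩)).trans (iSup₂_le fun w hw => ?_)
    rw [EReal.coe_le_coe_iff]
    -- If the gradient vanishes, the quotient is a division by zero, hence zero, and still below `K
    -- / ‖q‖`.
    rcases (norm_nonneg w.2).eq_or_lt with hw0 | hw0
    · rw [← hw0]; simp; positivity
    · rw [div_le_div_iff₀ (by positivity) hn]
      nlinarith [mul_le_mul_of_nonneg_right (h w hw.1) hn.le]
  rw [EReal.coe_le_coe_iff, le_div_iff₀ hn] at h1
  exact h1

theorem divForm_add {D : Domain d} (q r : L20 D) (w : FieldGrad D) :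
    divForm (q + r) w = divForm q w + divForm r w := by
  simp only [divForm_eq_inner, Submodule.coe_add, inner_add_left]

theorem divForm_smul {D : Domain d} (a : ℝ) (q : L20 D) (w : FieldGrad D) :
    divForm (a • q) w = a * divForm q w := by
  simp only [divForm_eq_inner, Submodule.coe_smul, real_inner_smul_left]

theorem sq_mul_sum_le {dt T : ℝ} {m : ℕ} (hdt : 0 ≤ dt) (hm : dt * m ≤ T) (f : ℕ → ℝ) :
    (dt * ∑ i ∈ Finset.range m, f i) ^ 2 ≤ T * (dt * ∑ i ∈ Finset.range m, f i ^ 2) := by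
  have h := sq_sum_le_card_mul_sum_sq (s := Finset.range m) (f := f)
  rw [Finset.card_range] at h
  have h0 : 0 ≤ ∑ i ∈ Finset.range m, f i ^ 2 := Finset.sum_nonneg fun i _ => sq_nonneg _
  calc (dt * ∑ i ∈ Finset.range m, f i) ^ 2
      = dt ^ 2 * (∑ i ∈ Finset.range m, f i) ^ 2 := by ring
    _ ≤ dt ^ 2 * (m * ∑ i ∈ Finset.range m, f i ^ 2) :=
        mul_le_mul_of_nonneg_left h (sq_nonneg dt)
    _ = dt * m * (dt * ∑ i ∈ Finset.range m, f i ^ 2) := by ring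
    _ ≤ T * (dt * ∑ i ∈ Finset.range m, f i ^ 2) :=
        mul_le_mul_of_nonneg_right hm (by positivity)

theorem displacement_bound {E α ρ γ k a b q M : ℝ} (hE : 0 < E) (hα : 0 < α) (hρ : 0 < ρ)
    (hγ : 0 < γ) (hk : 0 < k) (hb : 0 ≤ b) (hM : 0 ≤ M)
    (h : a ^ 2 ≤ b ^ 2 + E * α * k ^ 2 / γ * q) (hq : q ≤ ρ / (2 * α) * M ^ 2) :
    a ≤ b + k * Real.sqrt (E * ρ / (2 * γ)) * M := by
  refine le_of_abs_le (abs_le_of_sq_le_sq ?_ (by positivity))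
  have h1 := mul_le_mul_of_nonneg_left hq (by positivity : 0 ≤ E * α * k ^ 2 / γ)
  have hs : Real.sqrt (E * ρ / (2 * γ)) ^ 2 = E * ρ / (2 * γ) := Real.sq_sqrt (by positivity)
  have hs0 := Real.sqrt_nonneg (E * ρ / (2 * γ))
  generalize Real.sqrt (E * ρ / (2 * γ)) = s at *
  have e : E * α * k ^ 2 / γ * (ρ / (2 * α) * M ^ 2) = (k * s * M) ^ 2 := by
    rw [mul_pow, mul_pow, hs]
    field_simp
  have : 0 ≤ b * (k * s * M) := by positivity
  rw [e] at h1
  nlinarith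

/-- Two applications of weighted Cauchy–Schwarz, with weights `ρ²`, `νρT/P²` and `αρT/2` matched to
the three terms of the energy, give one square root instead of a sum of three. The weights add up to
the radicand of `C₄` times `ρ²`. -/
theorem weighted_sum_bound {α ν ρ P T dt a X x X2 x2 M : ℝ} (hα : 0 < α) (hν : 0 < ν)
    (hρ : 0 < ρ) (hP : 0 < P) (hT : 0 < T) (hdt : 0 < dt) (hX2 : 0 ≤ X2) (hx2 : 0 ≤ x2)
    (hM : 0 ≤ M) (hX : (dt * X) ^ 2 ≤ T * (dt * X2)) (hx : (dt * x) ^ 2 ≤ T * (dt * x2))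
    (h : a ^ 2 + dt * (ν / ρ * X2 + 2 * α / ρ * x2) ≤ M ^ 2) :
    ρ * a + ν / P * (dt * X) + α * (dt * x) ≤
      ρ * Real.sqrt (1 + T / ρ * (ν / P ^ 2 + α / 2)) * M := by
  refine le_of_abs_le (abs_le_of_sq_le_sq ?_ (by positivity))
  rw [mul_pow _ M, mul_pow, Real.sq_sqrt (by positivity)]
  have q1 : (ρ * a) ^ 2 ≤ ρ ^ 2 * a ^ 2 := by rw [mul_pow]
  have q2 : (ν / P * (dt * X)) ^ 2 ≤ (ν * ρ * T / P ^ 2) * (dt * (ν / ρ * X2)) := by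
    rw [mul_pow]
    refine (mul_le_mul_of_nonneg_left hX (by positivity)).trans (le_of_eq ?_)
    field_simp
  have q3 : (α * (dt * x)) ^ 2 ≤ (α * ρ * T / 2) * (dt * (2 * α / ρ * x2)) := by
    rw [mul_pow]
    refine (mul_le_mul_of_nonneg_left hx (by positivity)).trans (le_of_eq ?_)
    field_simp
  have s1 : 0 ≤ ν * ρ * T / P ^ 2 := by positivity
  have s2 : 0 ≤ α * ρ * T / 2 := by positivity
  have t1 : 0 ≤ dt * (ν / ρ * X2) := by positivity
  have t2 : 0 ≤ dt * (2 * α / ρ * x2) := by positivity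
  have q4 := sq_add_le_mul_of_sq_le (sq_nonneg ρ) s1 (sq_nonneg a) t1 q1 q2
  have q5 := sq_add_le_mul_of_sq_le (add_nonneg (sq_nonneg ρ) s1) s2
    (add_nonneg (sq_nonneg a) t1) t2 q4 q3
  refine q5.trans ?_
  have e : ρ ^ 2 + ν * ρ * T / P ^ 2 + α * ρ * T / 2 =
      ρ ^ 2 * (1 + T / ρ * (ν / P ^ 2 + α / 2)) := by
    field_simp
    ring
  rw [e]
  refine mul_le_mul_of_nonneg_left ?_ (by positivity)
  linarith

section Scheme

variable {D : Domain d} {c : Coeffs} {T dt h C β cP cK : ℝ} {N : ℕ}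
  {Uh Xh : Submodule ℝ (FieldGrad D)} {Qh : Submodule ℝ (L20 D)}
  {Pih : FieldGrad D → FieldGrad D} {u v : ℕ → FieldGrad D} {p : ℕ → L20 D}

/-- The time integral of the discrete pressure up to the `m`-th node. -/
def pressureImpulse (dt : ℝ) (p : ℕ → L20 D) (m : ℕ) : L20 D :=
  dt • ∑ i ∈ Finset.range m, p (i + 1)

theorem pressureImpulse_succ (dt : ℝ) (p : ℕ → L20 D) (m : ℕ) :
    pressureImpulse dt p (m + 1) = pressureImpulse dt p m + dt • p (m + 1) := by
  rw [pressureImpulse, Finset.sum_range_succ, smul_add, pressureImpulse]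

/-- Summation of the fluid equations times `dt`: both difference quotients telescope, so no negative
power of the step survives. -/
theorem IsDiscreteSolution.divForm_pressureImpulse (hdt : 0 < dt)
    (hsol : IsDiscreteSolution c dt N Uh Xh Qh u v p) {w : FieldGrad D} (hw : w ∈ Xh)
    {m : ℕ} (hm : m ≤ N) :
    divForm (pressureImpulse dt p m) w =
      c.ρ * inner ℝ ((v m).1 - (v 0).1) w.1
        + c.ν * (dt * ∑ i ∈ Finset.range m, inner ℝ (v (i + 1)).2 w.2)
        + c.α * (dt * ∑ i ∈ Finset.range m, inner ℝ (v (i + 1)).1 w.1)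
        - c.α * inner ℝ ((u m).1 - (u 0).1) w.1 := by
  induction m with
  | zero => simp [pressureImpulse, divForm_eq_inner]
  | succ m ih =>
    have h1 := hsol.fluid (m + 1) (by omega) hm w hw
    rw [Nat.add_sub_cancel] at h1
    rw [pressureImpulse_succ, divForm_add, divForm_smul, ih (by omega)]
    simp only [Finset.sum_range_succ, inner_sub_left] at h1 ⊢
    have h2 : dt * divForm (p (m + 1)) w =
        c.ρ * (inner ℝ (v (m + 1)).1 w.1 - inner ℝ (v m).1 w.1)
        + c.ν * (dt * inner ℝ (v (m + 1)).2 w.2) + c.α * (dt * inner ℝ (v (m + 1)).1 w.1)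
        - c.α * (inner ℝ (u (m + 1)).1 w.1 - inner ℝ (u m).1 w.1) := by
      have h3 : dt * (c.ρ / dt * (inner ℝ (v (m + 1)).1 w.1 - inner ℝ (v m).1 w.1)) =
        c.ρ * (inner ℝ (v (m + 1)).1 w.1 - inner ℝ (v m).1 w.1) := by field_simp
      have h4 : dt * (c.α / dt * (inner ℝ (u (m + 1)).1 w.1 - inner ℝ (u m).1 w.1)) =
        c.α * (inner ℝ (u (m + 1)).1 w.1 - inner ℝ (u m).1 w.1) := by field_simp
      have h5 := congrArg (dt * ·) h1
      simp only [mul_add, mul_sub] at h3 h4 h5 ⊢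
      linarith
    rw [h2]; ring

theorem IsDiscreteSolution.divForm_pressureImpulse_le (hc : c.Admissible d) (hdt : 0 < dt)
    (hXh : (Xh : Set (FieldGrad D)) ⊆ H10 D)
    (hsol : IsDiscreteSolution c dt N Uh Xh Qh u v p) (hP : IsPoincareConst D cP)
    {w : FieldGrad D} (hw : w ∈ Xh) {m : ℕ} (hm : m ≤ N) :
    divForm (pressureImpulse dt p m) w ≤
      cP * (c.ρ * (‖(v m).1‖ + ‖(v 0).1‖)
        + c.ν / cP * (dt * ∑ i ∈ Finset.range m, ‖(v (i + 1)).2‖)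
        + c.α * (dt * ∑ i ∈ Finset.range m, ‖(v (i + 1)).1‖)
        + c.α * (‖(u m).1‖ + ‖(u 0).1‖)) * ‖w.2‖ := by
  have hα := hc.α_pos
  have hν := hc.ν_pos
  have hρ := hc.ρ_pos
  have hP0 := hP.1
  have hw1 := hP.2 w (hXh hw)
  have b1 : inner ℝ ((v m).1 - (v 0).1) w.1 ≤ (‖(v m).1‖ + ‖(v 0).1‖) * (cP * ‖w.2‖) :=
    (real_inner_le_norm _ _).trans (mul_le_mul (norm_sub_le _ _) hw1 (norm_nonneg _)
      (by positivity))
  have b2 : -inner ℝ ((u m).1 - (u 0).1) w.1 ≤ (‖(u m).1‖ + ‖(u 0).1‖) * (cP * ‖w.2‖) :=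
    (neg_le_abs _).trans ((abs_real_inner_le_norm _ _).trans
      (mul_le_mul (norm_sub_le _ _) hw1 (norm_nonneg _) (by positivity)))
  have b3 : ∑ i ∈ Finset.range m, inner ℝ (v (i + 1)).2 w.2 ≤
      (∑ i ∈ Finset.range m, ‖(v (i + 1)).2‖) * ‖w.2‖ := by
    rw [Finset.sum_mul]
    exact Finset.sum_le_sum fun i _ => real_inner_le_norm _ _
  have b4 : ∑ i ∈ Finset.range m, inner ℝ (v (i + 1)).1 w.1 ≤
      (∑ i ∈ Finset.range m, ‖(v (i + 1)).1‖) * (cP * ‖w.2‖) := by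
    rw [Finset.sum_mul]
    exact Finset.sum_le_sum fun i _ => (real_inner_le_norm _ _).trans
      (mul_le_mul_of_nonneg_left hw1 (norm_nonneg _))
  rw [hsol.divForm_pressureImpulse hdt hw hm]
  have c1 := mul_le_mul_of_nonneg_left b1 hρ.le
  have c2 := mul_le_mul_of_nonneg_left b2 hα.le
  have c3 := mul_le_mul_of_nonneg_left b3 (mul_pos hν hdt).le
  have c4 := mul_le_mul_of_nonneg_left b4 (mul_pos hα hdt).le
  have e : cP * (c.ρ * (‖(v m).1‖ + ‖(v 0).1‖)
        + c.ν / cP * (dt * ∑ i ∈ Finset.range m, ‖(v (i + 1)).2‖)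
        + c.α * (dt * ∑ i ∈ Finset.range m, ‖(v (i + 1)).1‖)
        + c.α * (‖(u m).1‖ + ‖(u 0).1‖)) * ‖w.2‖ =
      c.ρ * ((‖(v m).1‖ + ‖(v 0).1‖) * (cP * ‖w.2‖))
        + c.ν * dt * ((∑ i ∈ Finset.range m, ‖(v (i + 1)).2‖) * ‖w.2‖)
        + c.α * dt * ((∑ i ∈ Finset.range m, ‖(v (i + 1)).1‖) * (cP * ‖w.2‖))
        + c.α * ((‖(u m).1‖ + ‖(u 0).1‖) * (cP * ‖w.2‖)) := by
    field_simp
  rw [e]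
  linarith

theorem IsDiscreteSolution.norm_pressureImpulse_le (hc : c.Admissible d) (hT : 0 < T) (hN : 0 < N)
    (hh : 0 < h) (hC : 0 < C) (hβ : 0 < β) (hinfsup : (β : EReal) ≤ discreteInfSup Xh Qh)
    (hUh : (Uh : Set (FieldGrad D)) ⊆ H10 D) (hXh : (Xh : Set (FieldGrad D)) ⊆ H10 D)
    (hPih : IsStableInterp Uh h C Pih) (hsol : IsDiscreteSolution c (T / N) N Uh Xh Qh u v p)
    (hP : IsPoincareConst D cP) (hK : IsKornConst D cK)
    (hstep : 6 * (C ^ 2 * c.D₄ d h (T / N) cP cK / (c.ν * c.ρ)) * (T / N) ≤ 1)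
    {m : ℕ} (hm : m ≤ N) :
    ‖pressureImpulse (T / N) p m‖ ≤ c.C₃ β cP ‖(u 0).1‖ ‖(v 0).1‖ + c.C₄ T β cP cK *
      Real.sqrt (c.C₁ d h (T / N) C ‖(u 0).1‖ ‖(v 0).1‖ *
        Real.exp (c.C₂ d h (T / N) C cP cK * T)) := by
  have hN' : (0 : ℝ) < N := Nat.cast_pos.2 hN
  have hdt : 0 < T / N := div_pos hT hN'
  have hα := hc.α_pos
  have hν := hc.ν_pos
  have hρ := hc.ρ_pos
  have hE := hc.E₁_pos
  have g1 := hc.γ₁_pos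
  have hP0 := hP.1
  have hK0 := hK.1
  have hen := hsol.energy_bound hc hT hN hh hC hUh hXh hPih hP hK hstep hm
  have hdis := hsol.norm_displacement_sq_le hc hT hN hUh hP hK hm
  set M2 := c.C₁ d h (T / N) C ‖(u 0).1‖ ‖(v 0).1‖ *
    Real.exp (c.C₂ d h (T / N) C cP cK * T) with hM2
  set M := Real.sqrt M2 with hM
  set SX := ∑ i ∈ Finset.range m, ‖(v (i + 1)).2‖ with hSX
  set Sx := ∑ i ∈ Finset.range m, ‖(v (i + 1)).1‖ with hSx
  set SX2 := ∑ i ∈ Finset.range m, ‖(v (i + 1)).2‖ ^ 2 with hSX2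
  set Sx2 := ∑ i ∈ Finset.range m, ‖(v (i + 1)).1‖ ^ 2 with hSx2
  have hSX0 : 0 ≤ SX := Finset.sum_nonneg fun i _ => norm_nonneg _
  have hSx0 : 0 ≤ Sx := Finset.sum_nonneg fun i _ => norm_nonneg _
  have hSX20 : 0 ≤ SX2 := Finset.sum_nonneg fun i _ => sq_nonneg _
  have hSx20 : 0 ≤ Sx2 := Finset.sum_nonneg fun i _ => sq_nonneg _
  rw [Finset.sum_add_distrib, ← Finset.mul_sum, ← Finset.mul_sum, ← hSX2, ← hSx2] at hen
  have hmT : T / N * m ≤ T := by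
    rw [div_mul_eq_mul_div, div_le_iff₀ hN']
    exact mul_le_mul_of_nonneg_left (by exact_mod_cast hm) hT.le
  have hX := sq_mul_sum_le hdt.le hmT (fun i => ‖(v (i + 1)).2‖)
  have hx := sq_mul_sum_le hdt.le hmT (fun i => ‖(v (i + 1)).1‖)
  simp only [← hSX, ← hSx, ← hSX2, ← hSx2] at hX hx
  generalize T / (N : ℝ) = dt at *
  have hM20 : 0 ≤ M2 := le_trans (by positivity) hen
  have hMsq : M ^ 2 = M2 := Real.sq_sqrt hM20
  have hM0 : 0 ≤ M := Real.sqrt_nonneg _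
  -- The drag dissipation in the energy bound controls the time sum of `‖v‖²`, which drives the
  -- growth of `u`.
  have hxM : dt * Sx2 ≤ c.ρ / (2 * c.α) * M ^ 2 := by
    have q : 2 * c.α / c.ρ * (dt * Sx2) ≤ M ^ 2 := by
      have : 0 ≤ dt * (c.ν / c.ρ * SX2) := by positivity
      rw [hMsq]
      linarith [sq_nonneg ‖(v m).1‖]
    have := mul_le_mul_of_nonneg_left q (by positivity : 0 ≤ c.ρ / (2 * c.α))
    refine le_trans (le_of_eq ?_) this
    field_simp
  have hu : ‖(u m).1‖ ≤ ‖(u 0).1‖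
      + cP * cK * Real.sqrt (c.E₁ * c.ρ / (2 * c.γ₁)) * M :=
    displacement_bound hE hα hρ g1 (mul_pos hP0 hK0) (norm_nonneg _) hM0 hdis hxM
  have hv : c.ρ * ‖(v m).1‖ + c.ν / cP * (dt * SX) + c.α * (dt * Sx) ≤
      c.ρ * Real.sqrt (1 + T / c.ρ * (c.ν / cP ^ 2 + c.α / 2)) * M :=
    weighted_sum_bound hα hν hρ hP0 hT hdt hSX20 hSx20 hM0 hX hx (hMsq ▸ hen)
  have hmem : pressureImpulse dt p m ∈ Qh :=
    Qh.smul_mem _ (Qh.sum_mem fun i hi => hsol.p_mem (i + 1) (by omega)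
      (by have := Finset.mem_range.1 hi; omega))
  have key := mul_norm_le_of_le_discreteInfSup hinfsup (by positivity) hmem
    fun w hw => hsol.divForm_pressureImpulse_le hc hdt hXh hP hw hm
  rw [← hSX, ← hSx] at key
  have hfin : cP * (c.ρ * (‖(v m).1‖ + ‖(v 0).1‖) + c.ν / cP * (dt * SX) + c.α * (dt * Sx)
        + c.α * (‖(u m).1‖ + ‖(u 0).1‖)) ≤
      β * (c.C₃ β cP ‖(u 0).1‖ ‖(v 0).1‖ + c.C₄ T β cP cK * M) := by
    have e : β * (c.C₃ β cP ‖(u 0).1‖ ‖(v 0).1‖ + c.C₄ T β cP cK * M) =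
        cP * (c.ρ * ‖(v 0).1‖ + 2 * c.α * ‖(u 0).1‖
          + c.α * (cP * cK * Real.sqrt (c.E₁ * c.ρ / (2 * c.γ₁)) * M)
          + c.ρ * Real.sqrt (1 + T / c.ρ * (c.ν / cP ^ 2 + c.α / 2)) * M) := by
      unfold Coeffs.C₃ Coeffs.C₄
      generalize Real.sqrt (c.E₁ * c.ρ / (2 * c.γ₁)) = s1
      generalize Real.sqrt (1 + T / c.ρ * (c.ν / cP ^ 2 + c.α / 2)) = s2
      field_simp
      ring
    rw [e]
    refine mul_le_mul_of_nonneg_left ?_ hP0.le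
    have := mul_le_mul_of_nonneg_left hu hα.le
    linarith
  exact le_of_mul_le_mul_left (key.trans hfin) hβ

end Scheme

/-! ### Integration by parts in time -/

/-- Integration by parts for two absolutely continuous primitives. Both vanish at `0`, and the
hypothesis removes the boundary product at `T`. -/
theorem integral_mul_primitive_eq_neg {T : ℝ} {z g : ℝ → ℝ}
    (hz : IntervalIntegrable z volume 0 T) (hg : IntervalIntegrable g volume 0 T)
    (h : (∫ s in (0 : ℝ)..T, z s) * ∫ s in (0 : ℝ)..T, g s = 0) :
    ∫ t in (0 : ℝ)..T, z t * ∫ s in (0 : ℝ)..t, g s =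
      -∫ t in (0 : ℝ)..T, (∫ s in (0 : ℝ)..t, z s) * g t := by
  have hZ := hz.absolutelyContinuousOnInterval_intervalIntegral (c := 0) left_mem_uIcc
  have hG := hg.absolutelyContinuousOnInterval_intervalIntegral (c := 0) left_mem_uIcc
  have hI := hZ.integral_mul_deriv_eq_deriv_mul hG
  rw [h] at hI
  simp only [intervalIntegral.integral_same, mul_zero, sub_zero, zero_sub] at hI
  have e1 : ∫ t in (0 : ℝ)..T, (∫ s in (0 : ℝ)..t, z s) * deriv (fun x => ∫ s in (0 : ℝ)..x, g s) t
      = ∫ t in (0 : ℝ)..T, (∫ s in (0 : ℝ)..t, z s) * g t := by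
    refine intervalIntegral.integral_congr_ae ?_
    filter_upwards [hg.ae_hasDerivAt_integral] with t ht htm
    rw [(ht (uIoc_subset_uIcc htm) 0 left_mem_uIcc).deriv]
  have e2 : ∫ t in (0 : ℝ)..T, deriv (fun x => ∫ s in (0 : ℝ)..x, z s) t * ∫ s in (0 : ℝ)..t, g s
      = ∫ t in (0 : ℝ)..T, z t * ∫ s in (0 : ℝ)..t, g s := by
    refine intervalIntegral.integral_congr_ae ?_
    filter_upwards [hz.ae_hasDerivAt_integral] with t ht htm
    rw [(ht (uIoc_subset_uIcc htm) 0 left_mem_uIcc).deriv]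
  rw [e1, e2] at hI
  rw [hI, neg_neg]

theorem setIntegral_Ioo_eq_intervalIntegral {T : ℝ} (hT : 0 < T) (f : ℝ → ℝ) :
    ∫ t in Ioo 0 T, f t = ∫ t in (0 : ℝ)..T, f t := by
  rw [intervalIntegral.integral_of_le hT.le, integral_Ioc_eq_integral_Ioo]

/-- A smooth function with compact support in `]0,T[` and vanishing integral has a primitive with
compact support in `]0,T[`. -/
theorem exists_primitive_of_integral_eq_zero {T : ℝ} {χ : ℝ → ℝ} (hχ : ContDiff ℝ ∞ χ)
    (hc : HasCompactSupport χ) (hs : tsupport χ ⊆ Ioo 0 T) (h0 : ∫ t, χ t = 0) :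
    ∃ ψ : ℝ → ℝ, ContDiff ℝ ∞ ψ ∧ HasCompactSupport ψ ∧ tsupport ψ ⊆ Ioo 0 T ∧ deriv ψ = χ := by
  rcases (tsupport χ).eq_empty_or_nonempty with hK | hK
  · have : χ = 0 := tsupport_eq_empty_iff.1 hK
    refine ⟨0, contDiff_const, HasCompactSupport.zero, ?_, ?_⟩
    · simp [tsupport]
    · rw [this]; exact deriv_const' 0
  have hKc : IsCompact (tsupport χ) := hc
  set a := sInf (tsupport χ) with ha
  set b := sSup (tsupport χ) with hb
  have haK := hs (hKc.sInf_mem hK)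
  have hbK := hs (hKc.sSup_mem hK)
  have hsub : tsupport χ ⊆ Icc a b := fun t ht =>
    ⟨csInf_le hKc.bddBelow ht, le_csSup hKc.bddAbove ht⟩
  have hout : ∀ t, t ∉ Icc a b → χ t = 0 := fun t ht =>
    image_eq_zero_of_notMem_tsupport fun h => ht (hsub h)
  have hint : ∀ x y, IntervalIntegrable χ volume x y := fun x y =>
    hχ.continuous.intervalIntegrable x y
  have hderiv : ∀ x, HasDerivAt (fun t => ∫ s in (0 : ℝ)..t, χ s) (χ x) x := fun x =>
    intervalIntegral.integral_hasDerivAt_right (hint _ _)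
      hχ.continuous.stronglyMeasurable.stronglyMeasurableAtFilter hχ.continuous.continuousAt
  have hd : deriv (fun t => ∫ s in (0 : ℝ)..t, χ s) = χ := funext fun x => (hderiv x).deriv
  have hzero : ∀ t, t ∉ Icc a b → ∫ s in (0 : ℝ)..t, χ s = 0 := by
    intro t ht
    rcases lt_or_ge t a with hta | hta
    · refine (intervalIntegral.integral_congr (g := fun _ => (0 : ℝ)) fun s hs' => ?_).trans
        (by simp)
      refine hout s fun h => ?_
      rcases le_max_iff.1 hs'.2 with h' | h'
      · exact absurd (haK.1.trans_le h.1) (not_lt.2 h')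
      · exact absurd (hta.trans_le h.1) (not_lt.2 h')
    · have htb : b < t := not_le.1 fun h => ht ⟨hta, h⟩
      have : Function.support χ ⊆ Ioc 0 t := fun s hs' => by
        have h := hsub (subset_tsupport χ hs')
        exact ⟨haK.1.trans_le h.1, h.2.trans htb.le⟩
      rw [intervalIntegral.integral_eq_integral_of_support_subset this, h0]
  have hts : tsupport (fun t => ∫ s in (0 : ℝ)..t, χ s) ⊆ Icc a b :=
    closure_minimal (fun t ht => by_contra fun h => ht (hzero t h)) isClosed_Icc
  refine ⟨fun t => ∫ s in (0 : ℝ)..t, χ s, ?_, ?_, ?_, hd⟩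
  · rw [contDiff_infty_iff_deriv, hd]
    exact ⟨fun x => (hderiv x).differentiableAt, hχ⟩
  · exact HasCompactSupport.of_support_subset_isCompact isCompact_Icc
      ((subset_tsupport _).trans hts)
  · exact hts.trans fun t ht => ⟨haK.1.trans_le ht.1, ht.2.trans_lt hbK.2⟩

/-- **du Bois-Reymond lemma**: a continuous function on `[0,T]` whose weak derivative vanishes is
constant. -/
theorem eq_const_of_integral_deriv_mul_eq_zero {T : ℝ} (hT : 0 < T) {H : ℝ → ℝ}
    (hH : ContinuousOn H (Icc 0 T))
    (h : ∀ ψ : ℝ → ℝ, ContDiff ℝ ∞ ψ → HasCompactSupport ψ → tsupport ψ ⊆ Ioo 0 T →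
      ∫ t in Ioo 0 T, deriv ψ t * H t = 0) :
    ∃ a, ∀ t ∈ Icc 0 T, H t = a := by
  have hHi : IntegrableOn H (Ioo 0 T) :=
    (hH.integrableOn_compact isCompact_Icc).mono_set Ioo_subset_Icc_self
  have hmul : ∀ η : ℝ → ℝ, Continuous η → HasCompactSupport η →
      IntegrableOn (fun t => η t * H t) (Ioo 0 T) := by
    intro η hη hηc
    obtain ⟨B, hB⟩ := hη.bounded_above_of_compact_support hηc
    exact hHi.bdd_mul hη.aestronglyMeasurable (ae_of_all _ hB)
  -- Subtracting the right multiple of a normalized bump makes any test function mean-free, hence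
  -- the derivative of a test function. The constant is then the average of `H` against this bump.
  let bump : ContDiffBump (T / 2) := ⟨T / 8, T / 4, by positivity, by linarith⟩
  set η₀ := bump.normed volume with hη₀
  have b1 : ContDiff ℝ ∞ η₀ := bump.contDiff_normed
  have b2 : HasCompactSupport η₀ := bump.hasCompactSupport_normed
  have b3 : tsupport η₀ ⊆ Ioo 0 T := by
    rw [hη₀, bump.tsupport_normed_eq, Real.closedBall_eq_Icc]
    intro t ht
    have h1 : T / 2 - T / 4 ≤ t := ht.1
    have h2 : t ≤ T / 2 + T / 4 := ht.2
    exact ⟨by linarith, by linarith⟩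
  have b4 : ∫ t, η₀ t = 1 := bump.integral_normed
  set a := ∫ t in Ioo 0 T, η₀ t * H t with ha
  have hae : ∀ᵐ t, t ∈ Ioo 0 T → H t - a = 0 := by
    refine isOpen_Ioo.ae_eq_zero_of_integral_contDiff_smul_eq_zero ?_ fun η h1 h2 h3 => ?_
    · exact (hHi.sub (integrableOn_const (by simp))).locallyIntegrableOn
    set m := ∫ t, η t with hm
    have hηi : Integrable η := h1.continuous.integrable_of_hasCompactSupport h2
    have hη₀i : Integrable η₀ := b1.continuous.integrable_of_hasCompactSupport b2
    have hts : tsupport (fun t => η t - m * η₀ t) ⊆ tsupport η ∪ tsupport η₀ := by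
      refine closure_minimal (fun t ht => ?_)
        ((isClosed_tsupport η).union (isClosed_tsupport η₀))
      by_contra hn
      rw [mem_union, not_or] at hn
      apply ht
      simp only [image_eq_zero_of_notMem_tsupport hn.1, image_eq_zero_of_notMem_tsupport hn.2]
      simp
    obtain ⟨ψ, p1, p2, p3, p4⟩ := exists_primitive_of_integral_eq_zero (T := T)
      (χ := fun t => η t - m * η₀ t) (h1.sub (contDiff_const.mul b1))
      (IsCompact.of_isClosed_subset (h2.isCompact.union b2.isCompact) (isClosed_tsupport _) hts)
      (hts.trans (union_subset h3 b3))
      (by rw [integral_sub hηi (hη₀i.const_mul m), integral_const_mul, b4]; simp [hm])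
    have h5 := h ψ p1 p2 p3
    rw [p4] at h5
    have e1 : ∫ t in Ioo 0 T, (η t - m * η₀ t) * H t = (∫ t in Ioo 0 T, η t * H t) - m * a := by
      rw [ha, ← integral_const_mul, ← integral_sub (hmul η h1.continuous h2)
        ((hmul η₀ b1.continuous b2).const_mul m)]
      refine integral_congr_ae (ae_of_all _ fun t => ?_)
      simp only; ring
    have e2 : ∫ t, η t • (H t - a) = ∫ t in Ioo 0 T, η t • (H t - a) := by
      refine (setIntegral_eq_integral_of_forall_compl_eq_zero fun t ht => ?_).symm
      rw [image_eq_zero_of_notMem_tsupport fun h => ht (h3 h), zero_smul]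
    have e3 : ∫ t in Ioo 0 T, η t * a = m * a := by
      rw [integral_mul_const, hm, setIntegral_eq_integral_of_forall_compl_eq_zero]
      intro t ht
      exact image_eq_zero_of_notMem_tsupport fun h => ht (h3 h)
    rw [e2]
    simp only [smul_eq_mul, mul_sub]
    rw [integral_sub (hmul η h1.continuous h2) (hηi.integrableOn.mul_const a), e3]
    linarith
  refine ⟨a, ?_⟩
  have hae' : H =ᵐ[volume.restrict (Ioo 0 T)] fun _ => a := by
    rw [EventuallyEq, ae_restrict_iff' measurableSet_Ioo]
    filter_upwards [hae] with t ht hm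
    linarith [ht hm]
  have hIoo : EqOn H (fun _ => a) (Ioo 0 T) :=
    Measure.eqOn_open_of_ae_eq hae' isOpen_Ioo (hH.mono Ioo_subset_Icc_self) continuousOn_const
  have := hIoo.of_subset_closure hH continuousOn_const Ioo_subset_Icc_self
    (by rw [closure_Ioo hT.ne])
  exact this

/-- The difference of `F` and the primitive of `g` has zero weak derivative, so it is constant, and
it vanishes at `0`. -/
theorem eq_primitive_of_weak_deriv {T : ℝ} (hT : 0 < T) {F g : ℝ → ℝ}
    (hF : ContinuousOn F (Icc 0 T)) (hF0 : F 0 = 0) (hg : IntegrableOn g (Ioo 0 T))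
    (h : ∀ ψ : ℝ → ℝ, ContDiff ℝ ∞ ψ → HasCompactSupport ψ → tsupport ψ ⊆ Ioo 0 T →
      ∫ t in Ioo 0 T, deriv ψ t * F t = -∫ t in Ioo 0 T, ψ t * g t) :
    ∀ t ∈ Icc 0 T, F t = ∫ s in (0 : ℝ)..t, g s := by
  have hgi : IntervalIntegrable g volume 0 T := by
    rw [intervalIntegrable_iff_integrableOn_Ioo_of_le hT.le]; exact hg
  have hG : ContinuousOn (fun t => ∫ s in (0 : ℝ)..t, g s) (Icc 0 T) := by
    have := (hgi.absolutelyContinuousOnInterval_intervalIntegral (c := 0)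
      left_mem_uIcc).continuousOn
    rwa [uIcc_of_le hT.le] at this
  obtain ⟨a, ha⟩ := eq_const_of_integral_deriv_mul_eq_zero hT (hF.sub hG) (by
    intro ψ h1 h2 h3
    have hψ' : Continuous (deriv ψ) := h1.continuous_deriv (by simp)
    have hprim : ∀ t, ∫ s in (0 : ℝ)..t, deriv ψ s = ψ t := by
      intro t
      rw [intervalIntegral.integral_deriv_eq_sub
        (fun x _ => (h1.differentiable (by simp)).differentiableAt)
        (hψ'.intervalIntegrable _ _),
        image_eq_zero_of_notMem_tsupport fun h => (h3 h).1.false, sub_zero]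
    have e := integral_mul_primitive_eq_neg (hψ'.intervalIntegrable 0 T) hgi (by
      rw [hprim, image_eq_zero_of_notMem_tsupport fun h => (h3 h).2.false, zero_mul])
    simp only [hprim] at e
    rw [← setIntegral_Ioo_eq_intervalIntegral hT, ← setIntegral_Ioo_eq_intervalIntegral hT] at e
    have hi : ∀ K : ℝ → ℝ, ContinuousOn K (Icc 0 T) →
        IntegrableOn (fun t => deriv ψ t * K t) (Ioo 0 T) := fun K hK =>
      ((hψ'.continuousOn.mul hK).integrableOn_compact isCompact_Icc).mono_set Ioo_subset_Icc_self
    have e' := integral_sub (hi _ hF) (hi _ hG)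
    simp only [← mul_sub] at e'
    simp only [Pi.sub_apply]
    rw [e', h ψ h1 h2 h3, e, sub_self])
  have h0 := ha 0 ⟨le_rfl, hT.le⟩
  simp only [Pi.sub_apply, hF0, intervalIntegral.integral_same, sub_zero] at h0
  intro t ht
  have := ha t ht
  simp only [Pi.sub_apply] at this
  linarith

section Hilbert

variable {X : Type} [NormedAddCommGroup X] [InnerProductSpace ℝ X] [CompleteSpace X] {T : ℝ}

/-- Pairing with a fixed `q` reduces the vector-valued statement to a scalar one. As `φ` vanishes at
`T`, so does the boundary term, whatever the primitive of `z` does there. -/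
theorem W110.integral_mul_inner_fn (hT : 0 < T) (φ : W110 T X) (q : X) {z : ℝ → ℝ}
    (hz : IntervalIntegrable z volume 0 T) :
    ∫ t in Ioo 0 T, z t * inner ℝ q (φ.fn t) =
      -∫ t in Ioo 0 T, (∫ s in (0 : ℝ)..t, z s) * inner ℝ q (φ.timeDeriv t) := by
  have hw : IsWeakTimeDeriv φ.fn φ.timeDeriv := φ.2.1
  obtain ⟨F, hF, hFe, hF0, hFT⟩ : VanishesAtEnds φ.fn := φ.2.2
  have hgi := L1.integrable_coeFn φ.timeDeriv
  have hgq : IntegrableOn (fun t => inner ℝ q (φ.timeDeriv t)) (Ioo 0 T) := hgi.const_inner q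
  have hprim := eq_primitive_of_weak_deriv hT (F := fun t => inner ℝ q (F t))
    (g := fun t => inner ℝ q (φ.timeDeriv t)) (continuousOn_const.inner hF)
    (by simp [hF0]) hgq (by
      intro ψ h1 h2 h3
      have e := congrArg (inner ℝ q) (hw ψ h1 h2 h3)
      rw [inner_neg_right, ← integral_inner (integrable_smul_test
        (h1.continuous_deriv (by simp)) h2.deriv φ.fn), ← integral_inner
        (integrable_smul_test h1.continuous h2 φ.timeDeriv)] at e
      simp only [real_inner_smul_right] at e
      rw [← e]
      refine integral_congr_ae ?_
      filter_upwards [hFe] with t ht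
      rw [← ht])
  have hgI : IntervalIntegrable (fun t => inner ℝ q (φ.timeDeriv t)) volume 0 T := by
    rw [intervalIntegrable_iff_integrableOn_Ioo_of_le hT.le]; exact hgq
  have hend : ∫ s in (0 : ℝ)..T, inner ℝ q (φ.timeDeriv s) = 0 := by
    rw [← hprim T ⟨hT.le, le_rfl⟩, hFT, inner_zero_right]
  have e := integral_mul_primitive_eq_neg hz hgI (by rw [hend, mul_zero])
  rw [← setIntegral_Ioo_eq_intervalIntegral hT, ← setIntegral_Ioo_eq_intervalIntegral hT] at e
  rw [← e]
  refine integral_congr_ae ?_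
  filter_upwards [hFe, ae_restrict_mem measurableSet_Ioo] with t ht htm
  rw [← hprim t (Ioo_subset_Icc_self htm), ht]

end Hilbert

/-! ### The step pressure as a functional -/

theorem integral_indicator_Ioc {a b t : ℝ} (ht : 0 ≤ t) :
    ∫ s in (0 : ℝ)..t, (Ioc a b).indicator (fun _ => (1 : ℝ)) s =
      max (min t b - max 0 a) 0 := by
  rw [intervalIntegral.integral_of_le ht, setIntegral_indicator measurableSet_Ioc, Ioc_inter_Ioc]
  simp [Measure.real, Real.volume_Ioc, ENNReal.toReal_ofReal']

section StepPressure

variable {D : Domain d} {T : ℝ} {N : ℕ} {p : ℕ → L20 D}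

theorem stepPressure_eq (dt : ℝ) (N : ℕ) (p : ℕ → L20 D) (t : ℝ) :
    stepPressure dt N p t = ∑ j ∈ Finset.range N,
      (Ioc (j * dt) ((j + 1) * dt)).indicator (fun _ => (1 : ℝ)) t • p (j + 1) := by
  have h : Finset.Icc 1 N = (Finset.range N).image (· + 1) := by
    ext i
    simp only [Finset.mem_Icc, Finset.mem_image, Finset.mem_range]
    exact ⟨fun hi => ⟨i - 1, by omega, by omega⟩, by rintro ⟨j, hj, rfl⟩; omega⟩
  rw [stepPressure, h, Finset.sum_image (by simp)]
  refine Finset.sum_congr rfl fun j _ => ?_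
  have e : (((j + 1 : ℕ) : ℝ) - 1) = j := by push_cast; ring
  rw [e]
  push_cast
  by_cases ht : t ∈ Ioc (j * dt) ((j + 1) * dt)
  · rw [indicator_of_mem ht, indicator_of_mem ht, one_smul]
  · rw [indicator_of_notMem ht, indicator_of_notMem ht, zero_smul]

/-- The sum is the primitive of the step pressure. Between two nodes it is a convex combination of
the adjacent impulses, so the nodal bound carries over. -/
theorem norm_sum_primitive_le (hT : 0 < T) (hN : 0 < N) {B : ℝ}
    (hB : ∀ m ≤ N, ‖pressureImpulse (T / N) p m‖ ≤ B) {t : ℝ} (ht : t ∈ Ioo 0 T) :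
    ‖∑ j ∈ Finset.range N, (∫ s in (0 : ℝ)..t,
      (Ioc (j * (T / N)) ((j + 1) * (T / N))).indicator (fun _ => (1 : ℝ)) s) • p (j + 1)‖ ≤ B := by
  have hN' : (0 : ℝ) < N := Nat.cast_pos.2 hN
  have hdt : 0 < T / N := div_pos hT hN'
  have hNdt : N * (T / N) = T := by field_simp
  set dt := T / N with hdtdef
  obtain ⟨k, hk1, hk2⟩ : ∃ k : ℕ, k * dt < t ∧ t ≤ (k + 1) * dt := by
    -- The ceiling minus one fits the half-open intervals, which contain their right endpoint.
    refine ⟨⌈t / dt⌉₊ - 1, ?_⟩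
    have hpos : 0 < ⌈t / dt⌉₊ := Nat.ceil_pos.2 (div_pos ht.1 hdt)
    have h1 := Nat.le_ceil (t / dt)
    have h2 := Nat.ceil_lt_add_one (div_pos ht.1 hdt).le
    rw [Nat.cast_pred hpos]
    rw [div_le_iff₀ hdt] at h1
    constructor
    · rw [← lt_div_iff₀ hdt]; linarith
    · rwa [sub_add_cancel]
  have hkN : k + 1 ≤ N := by
    have : (k : ℝ) < N := by
      have : (k : ℝ) * dt < N * dt := by rw [hNdt]; exact hk1.trans ht.2
      exact lt_of_mul_lt_mul_right this hdt.le
    exact_mod_cast this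
  have hval : ∀ j : ℕ, (∫ s in (0 : ℝ)..t,
      (Ioc (j * dt) ((j + 1) * dt)).indicator (fun _ => (1 : ℝ)) s) =
      max (min t ((j + 1) * dt) - j * dt) 0 := by
    intro j
    rw [integral_indicator_Ioc ht.1.le, max_eq_right (by positivity : (0 : ℝ) ≤ j * dt)]
  simp only [hval]
  have hsum : ∑ j ∈ Finset.range N, max (min t ((j + 1) * dt) - j * dt) 0 • p (j + 1) =
      pressureImpulse dt p k + (t - k * dt) • p (k + 1) := by
    rw [← Finset.sum_subset (Finset.range_subset_range.2 hkN), Finset.sum_range_succ]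
    · congr 1
      · rw [pressureImpulse, Finset.smul_sum]
        refine Finset.sum_congr rfl fun j hj => ?_
        have hj' : ((j : ℝ) + 1) ≤ k := by exact_mod_cast Finset.mem_range.1 hj
        have : ((j : ℝ) + 1) * dt ≤ k * dt := mul_le_mul_of_nonneg_right hj' hdt.le
        rw [min_eq_right (by linarith), max_eq_left (by linarith)]
        congr 1; ring
      · rw [min_eq_left hk2, max_eq_left (by linarith)]
    · intro j _ hj
      have hj' : (k : ℝ) + 1 ≤ j := by
        have := Finset.mem_range.not.1 hj
        exact_mod_cast not_lt.1 this
      have : ((k : ℝ) + 1) * dt ≤ j * dt := mul_le_mul_of_nonneg_right hj' hdt.le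
      rw [max_eq_right, zero_smul]
      linarith [min_le_left t ((j + 1) * dt)]
  set θ := (t - k * dt) / dt with hθ
  have hθ0 : 0 ≤ θ := div_nonneg (by linarith) hdt.le
  have hθ1 : θ ≤ 1 := (div_le_one hdt).2 (by linarith)
  have hconv : pressureImpulse dt p k + (t - k * dt) • p (k + 1) =
      (1 - θ) • pressureImpulse dt p k + θ • pressureImpulse dt p (k + 1) := by
    have : t - k * dt = θ * dt := by rw [hθ]; field_simp
    rw [pressureImpulse_succ, this]
    module
  rw [hsum, hconv]
  refine (norm_add_le _ _).trans ?_
  rw [norm_smul, norm_smul, Real.norm_of_nonneg (by linarith), Real.norm_of_nonneg hθ0]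
  have h1 := mul_le_mul_of_nonneg_left (hB k (by omega)) (by linarith : 0 ≤ 1 - θ)
  have h2 := mul_le_mul_of_nonneg_left (hB (k + 1) hkN) hθ0
  linarith

theorem L20.inner_smul_left (a : ℝ) (q r : L20 D) : inner ℝ (a • q) r = a * inner ℝ q r := by
  rw [Submodule.coe_inner, Submodule.coe_inner, Submodule.coe_smul]
  exact real_inner_smul_left (q : L2 D) (r : L2 D) a

theorem inner_stepPressure_eq (dt : ℝ) (N : ℕ) (p : ℕ → L20 D) (t : ℝ) (f : L20 D) :
    inner ℝ (stepPressure dt N p t) f = ∑ j ∈ Finset.range N,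
      (Ioc (j * dt) ((j + 1) * dt)).indicator (fun _ => (1 : ℝ)) t * inner ℝ (p (j + 1)) f := by
  rw [stepPressure_eq, sum_inner]
  exact Finset.sum_congr rfl fun j _ => L20.inner_smul_left _ _ _

theorem integrable_indicator_mul_inner (a b : ℝ) (q : L20 D) (f : L1Time T (L20 D)) :
    Integrable (fun t => (Ioc a b).indicator (fun _ => (1 : ℝ)) t * inner ℝ q (f t))
      (volume.restrict (Ioo 0 T)) := by
  have h : Integrable (fun t => inner ℝ q (f t)) (volume.restrict (Ioo 0 T)) :=
    (L1.integrable_coeFn f).const_inner q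
  refine (h.indicator (s := Ioc a b) measurableSet_Ioc).congr (ae_of_all _ fun t => ?_)
  by_cases ht : t ∈ Ioc a b <;> simp [ht]

theorem integrable_inner_stepPressure (dt : ℝ) (N : ℕ) (p : ℕ → L20 D) (f : L1Time T (L20 D)) :
    Integrable (fun t => inner ℝ (stepPressure dt N p t) (f t)) (volume.restrict (Ioo 0 T)) := by
  simp only [inner_stepPressure_eq]
  exact integrable_finsetSum _ fun j _ => integrable_indicator_mul_inner _ _ _ f

theorem abs_integral_inner_stepPressure_le (hT : 0 < T) (hN : 0 < N) {B : ℝ}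
    (hB : ∀ m ≤ N, ‖pressureImpulse (T / N) p m‖ ≤ B) (φ : W110 T (L20 D)) :
    |∫ t in Ioo 0 T, inner ℝ (stepPressure (T / N) N p t) (φ.fn t)| ≤ B * ‖φ.timeDeriv‖ := by
  set dt := T / N with hdt
  have hz : ∀ a b : ℝ,
      IntervalIntegrable ((Ioc a b).indicator fun _ => (1 : ℝ)) volume 0 T := fun a b => by
    rw [intervalIntegrable_iff]
    exact (integrableOn_const (by simp)).indicator measurableSet_Ioc
  set Z : ℕ → ℝ → ℝ := fun j t => ∫ s in (0 : ℝ)..t,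
    (Ioc (j * dt) ((j + 1) * dt)).indicator (fun _ => (1 : ℝ)) s with hZ
  have hgi := L1.integrable_coeFn φ.timeDeriv
  have hZi : ∀ j, Integrable (fun t => Z j t * inner ℝ (p (j + 1)) (φ.timeDeriv t))
      (volume.restrict (Ioo 0 T)) := by
    intro j
    have hc : ContinuousOn (Z j) (Icc 0 T) := by
      have := ((hz (j * dt) ((j + 1) * dt)).absolutelyContinuousOnInterval_intervalIntegral
        (c := 0) left_mem_uIcc).continuousOn
      rwa [uIcc_of_le hT.le] at this
    obtain ⟨A, hA⟩ := isCompact_Icc.exists_bound_of_continuousOn hc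
    refine (hgi.const_inner (p (j + 1))).bdd_mul (c := A)
      ((hc.mono Ioo_subset_Icc_self).aestronglyMeasurable measurableSet_Ioo) ?_
    filter_upwards [ae_restrict_mem measurableSet_Ioo] with t ht
    exact hA t (Ioo_subset_Icc_self ht)
  -- The step pressure is a finite sum of scalar indicators times fixed pressures, so integration by
  -- parts is applied to each mesh interval separately.
  have e : ∫ t in Ioo 0 T, inner ℝ (stepPressure dt N p t) (φ.fn t) =
      -∫ t in Ioo 0 T, inner ℝ (∑ j ∈ Finset.range N, Z j t • p (j + 1)) (φ.timeDeriv t) := by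
    have hs : ∀ t, inner ℝ (∑ j ∈ Finset.range N, Z j t • p (j + 1)) (φ.timeDeriv t) =
        ∑ j ∈ Finset.range N, Z j t * inner ℝ (p (j + 1)) (φ.timeDeriv t) := fun t => by
      rw [sum_inner]
      exact Finset.sum_congr rfl fun j _ => L20.inner_smul_left _ _ _
    simp only [inner_stepPressure_eq, hs]
    rw [integral_finsetSum _ fun j _ => integrable_indicator_mul_inner _ _ _ φ.fn,
      integral_finsetSum _ fun j _ => hZi j, ← Finset.sum_neg_distrib]
    exact Finset.sum_congr rfl fun j _ => φ.integral_mul_inner_fn hT (p (j + 1)) (hz _ _)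
  rw [e, abs_neg, L1.norm_eq_integral_norm, ← integral_const_mul, ← Real.norm_eq_abs]
  refine norm_integral_le_of_norm_le (hgi.norm.const_mul B) ?_
  filter_upwards [ae_restrict_mem measurableSet_Ioo] with t ht
  exact (norm_inner_le_norm _ _).trans
    (mul_le_mul_of_nonneg_right (norm_sum_primitive_le hT hN hB ht) (norm_nonneg _))

theorem exists_stepPressure_functional (hT : 0 < T) (hN : 0 < N) {B : ℝ}
    (hB : ∀ m ≤ N, ‖pressureImpulse (T / N) p m‖ ≤ B) :
    ∃ ℓ : WNeg1Inf T (L20 D), (∀ φ : W110 T (L20 D),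
      ℓ φ = ∫ t in Ioo 0 T, inner ℝ (stepPressure (T / N) N p t) (φ.fn t)) ∧ ‖ℓ‖ ≤ B := by
  have hB0 : 0 ≤ B := (norm_nonneg _).trans (hB 0 (Nat.zero_le _))
  let L : W110 T (L20 D) →ₗ[ℝ] ℝ :=
    { toFun := fun φ => ∫ t in Ioo 0 T, inner ℝ (stepPressure (T / N) N p t) (φ.fn t)
      map_add' := by
        intro φ χ
        rw [← integral_add (integrable_inner_stepPressure _ _ _ _)
          (integrable_inner_stepPressure _ _ _ _)]
        refine integral_congr_ae ?_
        filter_upwards [Lp.coeFn_add φ.fn χ.fn] with t ht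
        have : (φ + χ).fn = φ.fn + χ.fn := rfl
        rw [this, ht, Pi.add_apply, inner_add_right]
      map_smul' := by
        intro a φ
        rw [RingHom.id_apply, smul_eq_mul, ← integral_const_mul]
        refine integral_congr_ae ?_
        filter_upwards [Lp.coeFn_smul a φ.fn] with t ht
        have : (a • φ).fn = a • φ.fn := rfl
        rw [this, ht, Pi.smul_apply, real_inner_smul_right] }
  have hL : ∀ φ, ‖L φ‖ ≤ B * ‖φ‖ := fun φ => by
    refine (abs_integral_inner_stepPressure_le hT hN hB φ).trans ?_
    refine mul_le_mul_of_nonneg_left ?_ hB0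
    rw [W110.norm_eq]
    exact le_add_of_nonneg_left (norm_nonneg φ.fn)
  exact ⟨L.mkContinuous B hL, fun φ => rfl, L.mkContinuous_norm_le hB0 hL⟩

end StepPressure

end PorousFlow

end

/-! ### Existence of the constants and the dual norm bound -/

open PorousFlow
theorem proposition3p5
    (d : ℕ) (hd : d = 2 ∨ d = 3) (D : Domain d)
    (c : Coeffs) (hc : c.Admissible d)
    (T : ℝ) (hT : 0 < T) (N : ℕ) (hN : 1 < N)
    (h C β : ℝ) (hh : 0 < h) (hC : 0 < C) (hβ : 0 < β)
    (Uh Xh : Submodule ℝ (FieldGrad D)) (Qh : Submodule ℝ (L20 D))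
    [FiniteDimensional ℝ Uh] [FiniteDimensional ℝ Xh] [FiniteDimensional ℝ Qh]
    (hUh : (Uh : Set (FieldGrad D)) ⊆ H10 D) (hXh : (Xh : Set (FieldGrad D)) ⊆ H10 D)
    (hinfsup : (β : EReal) ≤ discreteInfSup Xh Qh)
    (Pih : FieldGrad D → FieldGrad D) (hPih : IsStableInterp Uh h C Pih)
    (u v : ℕ → FieldGrad D) (p : ℕ → L20 D)
    (hsol : IsDiscreteSolution c (T / N) N Uh Xh Qh u v p) :
    (∃ cP, IsPoincareConst D cP) ∧ (∃ cK, IsKornConst D cK) ∧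
      ∀ cP cK : ℝ, IsPoincareConst D cP → IsKornConst D cK →
        6 * (C ^ 2 * c.D₄ d h (T / N) cP cK / (c.ν * c.ρ)) * (T / N) ≤ 1 →
        ∃ ℓ : WNeg1Inf T (L20 D),
          (∀ φ : W110 T (L20 D),
            Integrable (fun t => inner ℝ (stepPressure (T / N) N p t) (φ.fn t))
                (MeasureTheory.volume.restrict (Set.Ioo 0 T)) ∧
              ℓ φ = ∫ t in Set.Ioo 0 T, inner ℝ (stepPressure (T / N) N p t) (φ.fn t)) ∧
          (∀ φ : W110 T (L20 D),
            |ℓ φ| ≤ 3 * (c.C₃ β cP ‖(u 0).1‖ ‖(v 0).1‖ + c.C₄ T β cP cK *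
              Real.sqrt (c.C₁ d h (T / N) C ‖(u 0).1‖ ‖(v 0).1‖ *
                Real.exp (c.C₂ d h (T / N) C cP cK * T))) * ‖φ.timeDeriv‖) ∧
          ‖ℓ‖ ≤ 3 * (c.C₃ β cP ‖(u 0).1‖ ‖(v 0).1‖ + c.C₄ T β cP cK *
            Real.sqrt (c.C₁ d h (T / N) C ‖(u 0).1‖ ‖(v 0).1‖ *
              Real.exp (c.C₂ d h (T / N) C cP cK * T))) := by
  have hN0 : 0 < N := by omega
  refine ⟨exists_isPoincareConst (by omega) D, exists_isKornConst D, ?_⟩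
  intro cP cK hP hK hstep
  have hB := fun m hm => hsol.norm_pressureImpulse_le hc hT hN0 hh hC hβ hinfsup hUh hXh hPih hP hK
    hstep (m := m) hm
  set B := c.C₃ β cP ‖(u 0).1‖ ‖(v 0).1‖ + c.C₄ T β cP cK *
    Real.sqrt (c.C₁ d h (T / N) C ‖(u 0).1‖ ‖(v 0).1‖ *
      Real.exp (c.C₂ d h (T / N) C cP cK * T))
  -- The argument yields the bound `B` itself; nonnegativity gives `B ≤ 3 * B`, so the factor 3 is
  -- slack.
  have hB0 : 0 ≤ B := (norm_nonneg _).trans (hB 0 (Nat.zero_le _))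
  obtain ⟨ℓ, hℓ, hℓn⟩ := exists_stepPressure_functional hT hN0 hB
  refine ⟨ℓ, fun φ => ⟨integrable_inner_stepPressure _ _ _ _, hℓ φ⟩, fun φ => ?_,
    hℓn.trans (by linarith)⟩
  rw [hℓ]
  exact (abs_integral_inner_stepPressure_le hT hN0 hB φ).trans
    (mul_le_mul_of_nonneg_right (by linarith) (norm_nonneg φ.timeDeriv))
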